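/- **Setting.** Let $Q,B,N_1\ge 0$ be integers (numbers of antennas, of batches, and of pixels per side), $N=N_1^2$, let $L>0$ be the side of the square field of view, $\lambda>0$ the wavelength, and $p_{bq}\in\mathbb R^2$ ($b\le B$, $q\le Q$) the projected antenna positions. Put $\Delta=L/N_1$ and $\varpi=L^2/\sqrt N$. Let $\boldsymbol F=\boldsymbol F_1\otimes\boldsymbol F_1$ be the unitary 2-D DFT on the centred $N_1\times N_1$ grid, and let $\boldsymbol G$ be the operator that interpolates on-grid frequencies (by the Dirichlet kernel) to the frequencies $\nu_{bkj}=(p_{bk}-p_{bj})/\lambda$, so that for every image $\boldsymbol x$ $$(\boldsymbol{GF}\boldsymbol x)_{(b,j,k)}=\Delta^2\sum_{\boldsymbol n} x_{\boldsymbol n}\,e^{-2\pi \mathrm i\,\nu_{bkj}^\top \boldsymbol n\Delta}$$ is the $(j,k)$ entry $(\mathcal I_b)_{jk}$ of the interferometric matrix of batch $b$. Let $\boldsymbol G_0$ be $\boldsymbol G$ with its DC rows ($j=k$) set to zero. Let $\mathcal V_0$ be the set of all nonzero $\nu_{bjk}$, and $V=|\mathcal V_0|$. For sketching vectors $\alpha_{pb},\beta_{pb}\in\mathbb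 C^Q$, $p\le P$, let $\boldsymbol R$ be the matrix that maps the vectorized matrices $(\mathcal I_b)_b$ to $\big(\sum_b\alpha_{pb}^*\mathcal I_b\beta_{pb}\big)_{p\le P}$. Write $\Sigma_K$ for the set of $v\in\mathbb R^N$ with at most $K$ nonzero entries, and $\|X\|_{\psi_2}=\inf\{t>0:\mathbb E\,e^{|X|^2/t^2}\le 2\}$. **Assumptions.** Let $K_0$ be an integer with $1\le K_0\le N$. (i) All visibilities of pairs of distinct antennas are nonzero and distinct: $V=Q(Q-1)B$. (ii) For some polynomial ${\rm plog}(N,K_0)$ in $\log N$, $\log K_0$ and $\log(1/\delta)$, taken at $\delta=\tfrac12$: if $V\ge\delta^{-2}K_0\,{\rm plog}(N,K_0)=4K_0\,{\rm plog}(N,K_0)$, then $\boldsymbol G_0\boldsymbol F$ satisfies the ${\rm RIP}_{\ell_2/\ell_2}(\Sigma_{K_0},\delta)$, i.e. $$(1-\delta)\|v\|_2^2\le\frac{N}{\varpi^2V}\|\boldsymbol G_0\boldsymbol Fv\|_2^2\le(1+\delta)\|v\|_2^2\qquad\text{for all }v\in\Sigma_{K_0}.$$ (iii) All the components of all the vectors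 $\alpha_{pb},\beta_{pb}$ are i.i.d. complex random variables with mean $0$, variance $\sigma^2>0$ and sub-Gaussian norm $\|\cdot\|_{\psi_2}\le\kappa$. **Claim.** There are constants $C,c,c_1,c_2>0$ that depend only on $\kappa$ and $\sigma$ (hence only on the sub-Gaussian norm bound when the sketches are normalized to unit variance) such that, in every such setting, if $$P\ge C K_0\ln\!\Big(\frac{12eN}{K_0}\Big)\quad\text{and}\quad V\ge 4K_0\,{\rm plog}(N,K_0),$$ then there are deterministic numbers $0<{\sf m}_{K_0}<{\sf M}_{K_0}$ with $${\sf m}_{K_0}>\tfrac23c_1\varpi\sqrt{\tfrac{V}{2N}},\qquad {\sf M}_{K_0}<\tfrac43c_2\varpi\sqrt{\tfrac{3V}{2N}},$$ such that, with probability exceeding $1-\exp(-cP)$, $${\sf m}_{K_0}\|v\|_2\le\tfrac1P\|\boldsymbol R\boldsymbol G_0\boldsymbol Fv\|_1\le{\sf M}_{K_0}\|v\|_2\qquad\text{for all }v\in\Sigma_{K_0}.$$ -/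

import Mathlib

open MeasureTheory ProbabilityTheory
open scoped Kronecker ComplexConjugate NNReal ENNReal

noncomputable section

namespace RadioInterferometry

/-! ### The pixel grid, sparse images and the discrete Fourier transform -/

/-- Indices of the pixels of an `N₁ × N₁` image, and of the on-grid 2-D frequencies. -/
abbrev Pixel (N₁ : ℕ) : Type := Fin N₁ × Fin N₁

/-- Integer coordinate of the `n`-th grid point of one axis of the centred grid
`-⌊N₁/2⌋, …, N₁ - 1 - ⌊N₁/2⌋`. -/
def gridCoord {N₁ : ℕ} (n : Fin N₁) : ℤ := (n : ℤ) - ((N₁ / 2 : ℕ) : ℤ)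

/-- The set `Σ_K` of the real images with at most `K` nonzero pixels. -/
def sparseImages (N₁ K : ℕ) : Set (EuclideanSpace ℝ (Pixel N₁)) :=
  {v | {n : Pixel N₁ | v n ≠ 0}.ncard ≤ K}

/-- The unitary 1-D DFT matrix `e^{-2πi k l / N₁} / √N₁`, on centred indices. -/
def dft1 (N₁ : ℕ) : Matrix (Fin N₁) (Fin N₁) ℂ :=
  Matrix.of fun k l =>
    Complex.exp (-(2 * Real.pi * Complex.I * (gridCoord k : ℂ) * (gridCoord l : ℂ) / (N₁ : ℂ)))
      / (Real.sqrt N₁ : ℂ)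

/-- The 2-D DFT matrix `F = F₁ ⊗ F₁`. -/
def dft2 (N₁ : ℕ) : Matrix (Pixel N₁) (Pixel N₁) ℂ := dft1 N₁ ⊗ₖ dft1 N₁

/-- A real image seen as a complex vector. -/
def toComplex {N₁ : ℕ} (v : EuclideanSpace ℝ (Pixel N₁)) : Pixel N₁ → ℂ := fun n => (v n : ℂ)

/-- The 1-D Dirichlet kernel `(1/N₁) ∑_s e^{2πi (χ/N₁ - f) s}`: the weight of the on-grid frequency
`χ` in the trigonometric interpolation of a DFT at the normalized frequency `f`. -/
def dirichletKernel (N₁ : ℕ) (f : ℝ) (χ : Fin N₁) : ℂ :=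
  (1 / (N₁ : ℂ)) * ∑ s : Fin N₁,
    Complex.exp (2 * Real.pi * Complex.I * ((gridCoord χ : ℂ) / (N₁ : ℂ) - (f : ℂ)) *
      (gridCoord s : ℂ))

/-- Orthogonality of the characters on the centred grid. -/
theorem sum_exp_gridCoord {N₁ : ℕ} (s n : Fin N₁) :
    ∑ χ : Fin N₁, Complex.exp (2 * Real.pi * Complex.I * (gridCoord χ : ℂ) *
      ((gridCoord s : ℂ) - (gridCoord n : ℂ)) / (N₁ : ℂ)) = if s = n then (N₁ : ℂ) else 0 := by
  have hN : N₁ ≠ 0 := by rintro rfl; exact s.elim0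
  have hNC : (N₁ : ℂ) ≠ 0 := by exact_mod_cast hN
  split_ifs with h
  · subst h
    simp
  · set d : ℤ := (s : ℤ) - (n : ℤ) with hd
    have hdC : (gridCoord s : ℂ) - (gridCoord n : ℂ) = (d : ℂ) := by
      simp [gridCoord, hd]
    set ζ : ℂ := Complex.exp (2 * Real.pi * Complex.I * d / N₁) with hζ
    have hterm : ∀ χ : Fin N₁, Complex.exp (2 * Real.pi * Complex.I * (gridCoord χ : ℂ) *
        ((gridCoord s : ℂ) - (gridCoord n : ℂ)) / (N₁ : ℂ)) =
        Complex.exp (-(2 * Real.pi * Complex.I * d / N₁ * ((N₁ / 2 : ℕ) : ℂ))) * ζ ^ (χ : ℕ) := by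
      intro χ
      rw [hdC, hζ, ← Complex.exp_nat_mul, ← Complex.exp_add]
      congr 1
      simp only [gridCoord, Int.cast_sub, Int.cast_natCast]
      ring
    rw [Finset.sum_congr rfl fun χ _ => hterm χ, ← Finset.mul_sum,
      Fin.sum_univ_eq_sum_range (fun k => ζ ^ k) N₁]
    have hpow : ζ ^ N₁ = 1 := by
      rw [hζ, ← Complex.exp_nat_mul, Complex.exp_eq_one_iff]
      exact ⟨d, by field_simp⟩
    have hne : ζ ≠ 1 := by
      intro h1
      rw [hζ, Complex.exp_eq_one_iff] at h1
      obtain ⟨m, hm⟩ := h1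
      have h2 : (d : ℂ) = m * N₁ := by
        have hpi : (2 * Real.pi * Complex.I : ℂ) ≠ 0 := Complex.two_pi_I_ne_zero
        field_simp at hm
        have := mul_left_cancel₀ hpi (by linear_combination (2 * Real.pi * Complex.I) * hm :
          (2 * Real.pi * Complex.I : ℂ) * d = 2 * Real.pi * Complex.I * (m * N₁))
        exact this
      have h3 : d = m * N₁ := by exact_mod_cast h2
      have hs := s.2
      have hn := n.2
      have h4 : d ≠ 0 := by
        intro h0
        exact h (Fin.ext (by omega))
      have h5 : |d| < N₁ := by rw [abs_lt]; omega
      exact h4 (Int.eq_zero_of_abs_lt_dvd ⟨m, by rw [h3]; ring⟩ h5)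
    have hgeom := mul_neg_geom_sum ζ N₁
    rw [hpow, sub_self] at hgeom
    rcases mul_eq_zero.mp hgeom with h0 | h0
    · exact absurd (sub_eq_zero.mp h0).symm hne
    · rw [h0, mul_zero]

/-- The Dirichlet kernel interpolates the 1-D DFT exactly. -/
theorem dirichletKernel_dft1 {N₁ : ℕ} (f : ℝ) (n : Fin N₁) :
    ∑ χ : Fin N₁, dirichletKernel N₁ f χ * dft1 N₁ χ n =
      Complex.exp (-(2 * Real.pi * Complex.I * (f : ℂ) * (gridCoord n : ℂ))) /
        (Real.sqrt N₁ : ℂ) := by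
  have hN : N₁ ≠ 0 := by rintro rfl; exact n.elim0
  have hNC : (N₁ : ℂ) ≠ 0 := by exact_mod_cast hN
  have hterm : ∀ χ s : Fin N₁,
      Complex.exp (2 * Real.pi * Complex.I * ((gridCoord χ : ℂ) / (N₁ : ℂ) - (f : ℂ)) *
        (gridCoord s : ℂ)) * dft1 N₁ χ n =
      Complex.exp (-(2 * Real.pi * Complex.I * (f : ℂ) * (gridCoord s : ℂ))) /
        (Real.sqrt N₁ : ℂ) * Complex.exp (2 * Real.pi * Complex.I * (gridCoord χ : ℂ) *
      ((gridCoord s : ℂ) - (gridCoord n : ℂ)) / (N₁ : ℂ)) := by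
    intro χ s
    simp only [dft1, Matrix.of_apply]
    rw [mul_div_assoc', div_mul_eq_mul_div, ← Complex.exp_add, ← Complex.exp_add]
    congr 2
    ring
  simp only [dirichletKernel, mul_assoc, Finset.sum_mul, ← Finset.mul_sum]
  simp only [← mul_assoc] at *
  rw [Finset.sum_comm]
  simp only [hterm, ← Finset.mul_sum, sum_exp_gridCoord]
  simp
  field_simp

/-! ### The interferometer -/

/-- The geometry of the acquisition: a square field of view of side `L`, the wavelength, and, for
each of the `B` batches, the positions of the `Q` antennas in the plane perpendicular to the
pointing direction. The image has `N = N₁²` pixels. -/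
structure Interferometer (Q B N₁ : ℕ) where
  /-- side of the field of view -/
  L : ℝ
  L_pos : 0 < L
  /-- wavelength of the monochromatic signal -/
  wavelength : ℝ
  wavelength_pos : 0 < wavelength
  /-- projected antenna positions, for each batch -/
  antenna : Fin B → Fin Q → Fin 2 → ℝ

namespace Interferometer

variable {Q B N₁ : ℕ} (S : Interferometer Q B N₁)

/-- The pixel width `Δ = L / N₁`. -/
def pixelWidth : ℝ := S.L / N₁

/-- The constant `ϖ = L² / √N`, with `N = N₁²`. -/
def varpi : ℝ := S.L ^ 2 / Real.sqrt ((N₁ : ℝ) ^ 2)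

/-- The visibility `ν_{bjk} = (p_{bj} - p_{bk}) / λ`. -/
def visibility (b : Fin B) (j k : Fin Q) : Fin 2 → ℝ :=
  fun a => (S.antenna b j a - S.antenna b k a) / S.wavelength

/-- The set `𝒱₀` of all nonzero visibilities, over all batches. -/
def visibilitySet : Set (Fin 2 → ℝ) :=
  (⋃ b : Fin B, {ν | ∃ j k : Fin Q, ν = S.visibility b j k}) \ {0}

/-- The number `V = |𝒱₀|` of nonzero visibilities. -/
def numVis : ℕ := S.visibilitySet.ncard

/-- All the visibilities of pairs of distinct antennas are nonzero and distinct, over all the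
batches: `|𝒱₀| = Q (Q - 1) B`. -/
def DistinctVisibilities : Prop := S.numVis = Q * (Q - 1) * B

/-- The interferometric matrix of the discrete image `x` at batch `b`. -/
def interferometricMatrix (b : Fin B) (x : Pixel N₁ → ℂ) : Matrix (Fin Q) (Fin Q) ℂ :=
  Matrix.of fun j k => (S.pixelWidth : ℂ) ^ 2 * ∑ n : Pixel N₁, x n *
    Complex.exp (-(2 * Real.pi * Complex.I *
      ((S.visibility b k j 0 : ℂ) * ((gridCoord n.1 : ℂ) * (S.pixelWidth : ℂ)) +
        (S.visibility b k j 1 : ℂ) * ((gridCoord n.2 : ℂ) * (S.pixelWidth : ℂ)))))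

/-- The interpolation operator `G`, from the on-grid frequencies of the DFT to the frequencies
`ν_{bkj}`; its rows are indexed by the entries `(j, k)` of the interferometric matrix of each
batch `b`. -/
def interp : Matrix (Fin B × Fin Q × Fin Q) (Pixel N₁) ℂ :=
  Matrix.of fun r χ => (S.varpi : ℂ) *
    (dirichletKernel N₁ (S.visibility r.1 r.2.2 r.2.1 0 * S.pixelWidth) χ.1 *
      dirichletKernel N₁ (S.visibility r.1 r.2.2 r.2.1 1 * S.pixelWidth) χ.2)

/-- The vectorized interferometric matrices are obtained by interpolating the DFT of the image:
`vec(I_b[x])_b = G F x`. -/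
theorem interp_mul_dft2_mulVec (x : Pixel N₁ → ℂ) (b : Fin B) (j k : Fin Q) :
    ((S.interp * dft2 N₁).mulVec x) (b, j, k) = S.interferometricMatrix b x j k := by
  simp only [Matrix.mulVec, dotProduct, interferometricMatrix, Matrix.of_apply, Finset.mul_sum]
  refine Finset.sum_congr rfl fun n _ => ?_
  have hN : N₁ ≠ 0 := by rintro rfl; exact n.1.elim0
  have hNC : (N₁ : ℂ) ≠ 0 := by exact_mod_cast hN
  have hsq : (Real.sqrt N₁ : ℂ) * (Real.sqrt N₁ : ℂ) = N₁ := by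
    rw [← Complex.ofReal_mul, Real.mul_self_sqrt (Nat.cast_nonneg _)]
    simp
  have hentry : (S.interp * dft2 N₁) (b, j, k) n = (S.varpi : ℂ) *
      ((∑ χ, dirichletKernel N₁ (S.visibility b k j 0 * S.pixelWidth) χ * dft1 N₁ χ n.1) *
        ∑ χ, dirichletKernel N₁ (S.visibility b k j 1 * S.pixelWidth) χ * dft1 N₁ χ n.2) := by
    rw [Matrix.mul_apply, Fintype.sum_prod_type, Finset.sum_mul_sum, Finset.mul_sum]
    refine Finset.sum_congr rfl fun χ _ => ?_
    rw [Finset.mul_sum]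
    refine Finset.sum_congr rfl fun χ' _ => ?_
    simp only [interp, dft2, Matrix.of_apply, Matrix.kroneckerMap_apply]
    ring
  rw [hentry, dirichletKernel_dft1, dirichletKernel_dft1, div_mul_div_comm, hsq,
    ← Complex.exp_add]
  have hv : (S.varpi : ℂ) / N₁ = (S.pixelWidth : ℂ) ^ 2 := by
    simp only [varpi, pixelWidth, Real.sqrt_sq (Nat.cast_nonneg N₁)]
    push_cast
    field_simp
  rw [← hv]
  push_cast
  rw [mul_div_assoc', div_mul_eq_mul_div, div_mul_eq_mul_div, mul_assoc, mul_comm (x n)]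
  congr 3
  congr 1
  ring

/-- The operator `G₀`: the rows of `G` that belong to the diagonals of the interferometric
matrices (the DC samples) are set to zero. -/
def interp₀ : Matrix (Fin B × Fin Q × Fin Q) (Pixel N₁) ℂ :=
  Matrix.of fun r χ => if r.2.1 = r.2.2 then 0 else S.interp r χ

/-- The `RIP_{ℓ₂/ℓ₂}(Σ_K, δ)` of `G₀ F`. -/
def VisibilityRIP (K : ℕ) (δ : ℝ) : Prop :=
  ∀ v ∈ sparseImages N₁ K,
    (1 - δ) * ‖v‖ ^ 2 ≤ (N₁ : ℝ) ^ 2 / (S.varpi ^ 2 * S.numVis) *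
        ∑ r, ‖((S.interp₀ * dft2 N₁).mulVec (toComplex v)) r‖ ^ 2 ∧
      (N₁ : ℝ) ^ 2 / (S.varpi ^ 2 * S.numVis) *
        ∑ r, ‖((S.interp₀ * dft2 N₁).mulVec (toComplex v)) r‖ ^ 2 ≤ (1 + δ) * ‖v‖ ^ 2

end Interferometer

/-- The value of a polynomial in `log N`, `log K` and `log (1/δ)`. -/
def plogValue (plog : MvPolynomial (Fin 3) ℝ) (N K : ℕ) (δ : ℝ) : ℝ :=
  MvPolynomial.eval ![Real.log N, Real.log K, Real.log (1 / δ)] plog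

/-- The assumption on the visibility sampling: `G₀ F` satisfies the `RIP_{ℓ₂/ℓ₂}(Σ_K, δ)`, provided
that `V ≥ δ⁻² K plog(N, K, 1/δ)`. -/
def Interferometer.VisibilityRIPAssumption {Q B N₁ : ℕ} (S : Interferometer Q B N₁)
    (plog : MvPolynomial (Fin 3) ℝ) (K : ℕ) (δ : ℝ) : Prop :=
  (δ ^ 2)⁻¹ * K * plogValue plog (N₁ ^ 2) K δ ≤ S.numVis → S.VisibilityRIP K δ

/-! ### Rank-one projections with random sketches -/

/-- The ROP matrix `R = [R₁, …, R_B]`: its `p`-th row maps the vectorized interferometric matrices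
`(I_b)_b` to `∑_b α_{pb}^* I_b β_{pb}`. -/
def ropMatrix {P Q B : ℕ} (α β : Fin P → Fin B → Fin Q → ℂ) :
    Matrix (Fin P) (Fin B × Fin Q × Fin Q) ℂ :=
  Matrix.of fun p r => conj (α p r.1 r.2.1) * β p r.1 r.2.2

/-- The centred IROP operator `R G₀ F`. -/
def irop {P Q B N₁ : ℕ} (S : Interferometer Q B N₁) (α β : Fin P → Fin B → Fin Q → ℂ) :
    Matrix (Fin P) (Pixel N₁) ℂ :=
  ropMatrix α β * S.interp₀ * dft2 N₁

/-- The `RIP_{ℓ₂/ℓ₁}(Σ_K, m, M)` of an operator with `P` measurements. -/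
def RIPL2L1 {P N₁ : ℕ} (A : Matrix (Fin P) (Pixel N₁) ℂ) (K : ℕ) (m M : ℝ) : Prop :=
  0 < m ∧ m < M ∧ ∀ v ∈ sparseImages N₁ K,
    m * ‖v‖ ≤ 1 / (P : ℝ) * ∑ p, ‖(A.mulVec (toComplex v)) p‖ ∧
      1 / (P : ℝ) * ∑ p, ‖(A.mulVec (toComplex v)) p‖ ≤ M * ‖v‖

/-- The sub-Gaussian norm `‖X‖_{ψ₂} = inf {t > 0 : E exp(|X|² / t²) ≤ 2}` (infinite if `X` is not
sub-Gaussian). -/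
def subGaussianNorm {Ω : Type*} [MeasurableSpace Ω] (X : Ω → ℂ) (μ : Measure Ω) : ℝ≥0∞ :=
  ⨅ (t : ℝ) (_ : 0 < t)
    (_ : ∫⁻ ω, ENNReal.ofReal (Real.exp (‖X ω‖ ^ 2 / t ^ 2)) ∂μ ≤ 2), ENNReal.ofReal t

/-- The family of all the components of all the sketching vectors `α_{pb}` and `β_{pb}`. -/
def sketchComponents {P Q B : ℕ} {Ω : Type*} (α β : Ω → Fin P → Fin B → Fin Q → ℂ) :
    (Fin P × Fin B × Fin Q) ⊕ (Fin P × Fin B × Fin Q) → Ω → ℂ :=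
  Sum.elim (fun i ω => α ω i.1 i.2.1 i.2.2) (fun i ω => β ω i.1 i.2.1 i.2.2)

/-- The sketching vectors have i.i.d. complex components, centred, of variance `σ²`, and of
sub-Gaussian norm at most `κ`. -/
structure SubGaussianSketches {P Q B : ℕ} {Ω : Type*} [MeasurableSpace Ω] (μ : Measure Ω)
    (α β : Ω → Fin P → Fin B → Fin Q → ℂ) (κ σ : ℝ≥0) : Prop where
  measurable : ∀ i, Measurable (sketchComponents α β i)
  indep : iIndepFun (sketchComponents α β) μ
  identDistrib : ∀ i j, IdentDistrib (sketchComponents α β i) (sketchComponents α β j) μ μ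
  mean_zero : ∀ i, ∫ ω, sketchComponents α β i ω ∂μ = 0
  variance_eq : ∀ i, ∫ ω, ‖sketchComponents α β i ω‖ ^ 2 ∂μ = (σ : ℝ) ^ 2
  subGaussian : ∀ i, subGaussianNorm (sketchComponents α β i) μ ≤ κ

end RadioInterferometry

end

/-!
The `p`-th measurement of an image `v` is `Z_p(v) = α_p^* J(v) β_p`, where `J(v)` is the
block-diagonal matrix of the hollow interferometric matrices of `v`, and the restricted isometry
property of the visibility sampling says that the Frobenius norm of `J(v)` is comparable to
`ϖ √(V / N) ‖v‖` on sparse images. What has to be shown is that the average of the `|Z_p(v)|` is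
comparable to this Frobenius norm, with high probability and uniformly over the sparse images.

*One image.* For `‖J‖_F = 1`, two facts about `Z = α^* J β` suffice. It has an exponential moment
`E exp(t |Z|) ≤ 4` with `t` of order `1 / K²`, where `K` is a scale of sub-Gaussianity
(`IsSubGaussianFamily.lintegral_exp_norm_bilinearForm_le`): conditionally on `β` it is a
sub-Gaussian sum of variance proxy `‖J β‖²`, and `‖J β‖²` has an exponential moment because each of
its terms has one. Its second moment is `σ⁴`
(`IsSubGaussianFamily.lintegral_norm_sq_bilinearForm`). The exponential moment gives the upper tail
of the average by Chernoff's bound. As the third moment of `|Z|` is bounded, a second moment `σ⁴`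
forces a first moment bounded away from `0`, hence a Laplace transform below `1`
(`integral_exp_neg_mul_le`), and Chernoff's bound gives the lower tail too. Both tails are
exponentially small in `P` (`exists_tail_bounds`).

*All sparse images.* The unit sphere of the images supported on a given set of `K₀` pixels has an
`ε`-net with at most `(3 / ε) ^ K₀` points (`exists_net_unitSphere`), two-sided bounds of a seminorm
on such a net extend to the whole sphere (`bounds_of_bounds_on_net`), and there are at most
`(e N / K₀) ^ K₀` supports. With `P ≥ C K₀ log (12 e N / K₀)`, a union bound over the nets of all
the supports costs only half of the exponent (`net_card_mul_exp_lt`).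
-/

namespace RadioInterferometry

/-! ### Real sub-Gaussian variables -/

theorem exp_le_add_exp_sq (x : ℝ) : Real.exp x ≤ x + Real.exp (x ^ 2) := by
  have hsq := Real.add_one_le_exp (x ^ 2)
  rcases le_or_gt |x| 1 with h | h
  · have := (abs_le.mp (Real.abs_exp_sub_one_sub_id_le h)).2
    linarith
  · rcases lt_abs.mp h with h | h
    · have : Real.exp x ≤ Real.exp (x ^ 2) := Real.exp_le_exp.mpr (by nlinarith)
      linarith
    · have : Real.exp x ≤ 1 := Real.exp_le_one_iff.mpr (by linarith)
      nlinarith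

theorem exp_mul_le_of_mem_Icc {θ : ℝ} (h0 : 0 ≤ θ) (h1 : θ ≤ 1) (u : ℝ) :
    Real.exp (θ * u) ≤ (1 - θ) + θ * Real.exp u := by
  have := convexOn_exp.2 (Set.mem_univ 0) (Set.mem_univ u) (sub_nonneg.mpr h1) h0 (by ring)
  simpa using this

section

variable {Ω : Type*} [MeasurableSpace Ω] {μ : Measure Ω} [IsProbabilityMeasure μ]

/-- A centred variable with `E exp(X² / K²) ≤ 2` has a sub-Gaussian moment generating function. -/
theorem hasSubgaussianMGF_of_lintegral_exp_sq_le {X : Ω → ℝ} {K : ℝ≥0} (hK : 0 < K)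
    (hX : Measurable X) (hmean : ∫ ω, X ω ∂μ = 0)
    (hexp : ∫⁻ ω, ENNReal.ofReal (Real.exp (X ω ^ 2 / K ^ 2)) ∂μ ≤ 2) :
    HasSubgaussianMGF X (2 * K ^ 2) μ := by
  have hK' : (0 : ℝ) < K := hK
  have hmeas : Measurable fun ω => Real.exp (X ω ^ 2 / K ^ 2) := by fun_prop
  have hI : Integrable (fun ω => Real.exp (X ω ^ 2 / K ^ 2)) μ := by
    refine ⟨hmeas.aestronglyMeasurable, ?_⟩
    rw [hasFiniteIntegral_iff_ofReal (Filter.Eventually.of_forall fun ω => (Real.exp_pos _).le)]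
    exact hexp.trans_lt (by simp)
  have hle : ∫ ω, Real.exp (X ω ^ 2 / K ^ 2) ∂μ ≤ 2 := by
    rw [integral_eq_lintegral_of_nonneg_ae
      (Filter.Eventually.of_forall fun ω => (Real.exp_pos _).le) hmeas.aestronglyMeasurable]
    exact ENNReal.toReal_le_of_le_ofReal (by norm_num) (by simpa using hexp)
  have hIθ : ∀ θ : ℝ, 0 ≤ θ → θ ≤ 1 → Integrable (fun ω => Real.exp (θ * (X ω ^ 2 / K ^ 2))) μ := by
    intro θ h0 h1
    refine hI.mono' (by fun_prop) (Filter.Eventually.of_forall fun ω => ?_)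
    rw [Real.norm_of_nonneg (Real.exp_pos _).le]
    refine Real.exp_le_exp.mpr (mul_le_of_le_one_left (by positivity) h1)
  have hleθ : ∀ θ : ℝ, 0 ≤ θ → θ ≤ 1 →
      ∫ ω, Real.exp (θ * (X ω ^ 2 / K ^ 2)) ∂μ ≤ Real.exp θ := by
    intro θ h0 h1
    calc ∫ ω, Real.exp (θ * (X ω ^ 2 / K ^ 2)) ∂μ
        ≤ ∫ ω, ((1 - θ) + θ * Real.exp (X ω ^ 2 / K ^ 2)) ∂μ :=
          integral_mono (hIθ θ h0 h1) ((integrable_const _).add (hI.const_mul _))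
            fun ω => exp_mul_le_of_mem_Icc h0 h1 _
      _ = (1 - θ) + θ * ∫ ω, Real.exp (X ω ^ 2 / K ^ 2) ∂μ := by
          rw [integral_add (integrable_const _) (hI.const_mul _), integral_const_mul]
          simp
      _ ≤ θ + 1 := by nlinarith
      _ ≤ Real.exp θ := Real.add_one_le_exp θ
  have hpt : ∀ t x : ℝ, t * x ≤ t ^ 2 * K ^ 2 / 2 + 1 / 2 * (x ^ 2 / K ^ 2) := by
    intro t x
    have h : t ^ 2 * K ^ 2 / 2 + 1 / 2 * (x ^ 2 / K ^ 2) - t * x = 1 / 2 * (t * K - x / K) ^ 2 := by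
      field_simp
      ring
    nlinarith [sq_nonneg (t * K - x / K)]
  have hint : ∀ t : ℝ, Integrable (fun ω => Real.exp (t * X ω)) μ := by
    intro t
    refine ((hIθ (1 / 2) (by norm_num) (by norm_num)).const_mul
      (Real.exp (t ^ 2 * K ^ 2 / 2))).mono' (by fun_prop) (Filter.Eventually.of_forall fun ω => ?_)
    rw [Real.norm_of_nonneg (Real.exp_pos _).le, ← Real.exp_add]
    exact Real.exp_le_exp.mpr (hpt t _)
  have hXI : Integrable X μ := by
    refine ((hint 1).add (hint (-1))).mono' (by fun_prop) (Filter.Eventually.of_forall fun ω => ?_)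
    have h1 := Real.add_one_le_exp (X ω)
    have h2 := Real.add_one_le_exp (-X ω)
    have h3 := Real.exp_pos (X ω)
    have h4 := Real.exp_pos (-X ω)
    simp only [Pi.add_apply, one_mul, neg_mul, Real.norm_eq_abs, abs_le]
    constructor <;> linarith
  refine ⟨hint, fun t => ?_⟩
  have hgoal : ((2 * K ^ 2 : ℝ≥0) : ℝ) * t ^ 2 / 2 = t ^ 2 * K ^ 2 := by
    push_cast
    ring
  rw [hgoal]
  -- For small `t` the zero mean enters through `exp x ≤ x + exp (x²)`; for large `t` the bound
  -- `t x ≤ t² K² / 2 + x² / (2 K²)` is already enough.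
  rcases le_or_gt (t ^ 2 * (K : ℝ) ^ 2) 1 with h | h
  · have heq : ∀ ω, (t * X ω) ^ 2 = t ^ 2 * K ^ 2 * (X ω ^ 2 / K ^ 2) := by
      intro ω
      field_simp
    calc mgf X μ t ≤ ∫ ω, (t * X ω + Real.exp (t ^ 2 * K ^ 2 * (X ω ^ 2 / K ^ 2))) ∂μ := by
          refine integral_mono (hint t) ((hXI.const_mul t).add (hIθ _ (by positivity) h)) fun ω => ?_
          rw [← heq]
          exact exp_le_add_exp_sq _
      _ = ∫ ω, Real.exp (t ^ 2 * K ^ 2 * (X ω ^ 2 / K ^ 2)) ∂μ := by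
          rw [integral_add (hXI.const_mul t) (hIθ _ (by positivity) h), integral_const_mul, hmean]
          simp
      _ ≤ _ := hleθ _ (by positivity) h
  · calc mgf X μ t
        ≤ ∫ ω, Real.exp (t ^ 2 * K ^ 2 / 2) * Real.exp (1 / 2 * (X ω ^ 2 / K ^ 2)) ∂μ := by
          refine integral_mono (hint t)
            ((hIθ (1 / 2) (by norm_num) (by norm_num)).const_mul _) fun ω => ?_
          simp only
          rw [← Real.exp_add]
          exact Real.exp_le_exp.mpr (hpt t _)
      _ ≤ Real.exp (t ^ 2 * K ^ 2 / 2) * Real.exp (1 / 2) := by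
          rw [integral_const_mul]
          exact mul_le_mul_of_nonneg_left (hleθ _ (by norm_num) (by norm_num)) (Real.exp_pos _).le
      _ ≤ _ := by
          rw [← Real.exp_add]
          exact Real.exp_le_exp.mpr (by linarith)

omit [IsProbabilityMeasure μ] in
theorem lintegral_ofReal_exp_mul_le {Y : Ω → ℝ} {c : ℝ≥0} (hY : HasSubgaussianMGF Y c μ) (t : ℝ) :
    ∫⁻ ω, ENNReal.ofReal (Real.exp (t * Y ω)) ∂μ ≤ ENNReal.ofReal (Real.exp (c * t ^ 2 / 2)) := by
  rw [← ofReal_integral_eq_lintegral_ofReal (hY.integrable_exp_mul t)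
    (Filter.Eventually.of_forall fun ω => (Real.exp_pos _).le)]
  exact ENNReal.ofReal_le_ofReal (hY.mgf_le t)

theorem lintegral_exp_mul_gaussianReal (s : ℝ) :
    ∫⁻ g, ENNReal.ofReal (Real.exp (s * g)) ∂(gaussianReal 0 1) =
      ENNReal.ofReal (Real.exp (s ^ 2 / 2)) := by
  rw [← ofReal_integral_eq_lintegral_ofReal (integrable_exp_mul_gaussianReal s)
    (Filter.Eventually.of_forall fun ω => (Real.exp_pos _).le)]
  have := congrFun (mgf_id_gaussianReal (μ := 0) (v := 1)) s
  simp only [mgf, id] at this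
  rw [this]
  simp

theorem lintegral_exp_sq_gaussianReal_le {u : ℝ} (hu : u ≤ 3 / 8) :
    ∫⁻ g, ENNReal.ofReal (Real.exp (u * g ^ 2)) ∂(gaussianReal 0 1) ≤ 2 := by
  have hI : Integrable (fun x : ℝ => Real.exp (-(1 / 8) * x ^ 2)) :=
    integrable_exp_neg_mul_sq (by norm_num)
  have hpi := Real.pi_pos
  rw [gaussianReal_of_var_ne_zero _ one_ne_zero,
    lintegral_withDensity_eq_lintegral_mul _ (measurable_gaussianPDF 0 1) (by fun_prop)]
  calc ∫⁻ g, (gaussianPDF 0 1 * fun g => ENNReal.ofReal (Real.exp (u * g ^ 2))) g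
      ≤ ∫⁻ g, ENNReal.ofReal ((√(2 * Real.pi))⁻¹ * Real.exp (-(1 / 8) * g ^ 2)) := by
        refine lintegral_mono fun g => ?_
        simp only [Pi.mul_apply, gaussianPDF, gaussianPDFReal]
        rw [← ENNReal.ofReal_mul (by positivity)]
        refine ENNReal.ofReal_le_ofReal ?_
        simp only [NNReal.coe_one, mul_one, sub_zero]
        rw [mul_assoc, ← Real.exp_add]
        gcongr
        nlinarith [sq_nonneg g]
    _ = ENNReal.ofReal ((√(2 * Real.pi))⁻¹ * √(Real.pi / (1 / 8))) := by
        rw [← ofReal_integral_eq_lintegral_ofReal (hI.const_mul _)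
          (Filter.Eventually.of_forall fun g => by positivity), integral_const_mul,
          integral_gaussian]
    _ = 2 := by
        have : √(Real.pi / (1 / 8)) = 2 * √(2 * Real.pi) := by
          rw [show Real.pi / (1 / 8) = 2 ^ 2 * (2 * Real.pi) by ring, Real.sqrt_mul (by norm_num),
            Real.sqrt_sq (by norm_num)]
        rw [this, mul_comm, mul_assoc, mul_inv_cancel₀ (by positivity)]
        simp

/-- The exponential of the square is linearized by an independent standard Gaussian `g`:
`exp (θ y²) = E_g exp (√(2θ) g y)`. The moment generating function of `Y` then leaves a Gaussian
integral. -/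
theorem lintegral_exp_sq_le {Y : Ω → ℝ} {c : ℝ≥0} (hY : HasSubgaussianMGF Y c μ)
    (hYm : Measurable Y) {θ : ℝ} (hθ : 0 ≤ θ) (hθc : θ * c ≤ 3 / 8) :
    ∫⁻ ω, ENNReal.ofReal (Real.exp (θ * Y ω ^ 2)) ∂μ ≤ 2 := by
  calc ∫⁻ ω, ENNReal.ofReal (Real.exp (θ * Y ω ^ 2)) ∂μ
      = ∫⁻ ω, ∫⁻ g, ENNReal.ofReal (Real.exp (√(2 * θ) * g * Y ω)) ∂(gaussianReal 0 1) ∂μ := by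
        refine lintegral_congr fun ω => ?_
        have h : ∀ g : ℝ, √(2 * θ) * g * Y ω = (√(2 * θ) * Y ω) * g := fun g => by ring
        simp only [h]
        rw [lintegral_exp_mul_gaussianReal, mul_pow, Real.sq_sqrt (by positivity)]
        congr 2
        ring
    _ = ∫⁻ g, ∫⁻ ω, ENNReal.ofReal (Real.exp (√(2 * θ) * g * Y ω)) ∂μ ∂(gaussianReal 0 1) :=
        lintegral_lintegral_swap (by
          refine Measurable.aemeasurable ?_
          fun_prop)
    _ ≤ ∫⁻ g, ENNReal.ofReal (Real.exp ((θ * c) * g ^ 2)) ∂(gaussianReal 0 1) := by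
        refine lintegral_mono fun g => (lintegral_ofReal_exp_mul_le hY _).trans_eq ?_
        rw [mul_pow, Real.sq_sqrt (by positivity)]
        congr 2
        ring
    _ ≤ 2 := lintegral_exp_sq_gaussianReal_le hθc

end

/-! ### Linear combinations of sub-Gaussian variables -/

section

variable {Ω : Type*} [MeasurableSpace Ω] {μ : Measure Ω} {ι κ : Type*}

/-- A family of independent centred complex random variables of variance `σ²`, such that
`E exp(|X|² / K²) ≤ 2`. -/
structure IsSubGaussianFamily (X : ι → Ω → ℂ) (K : ℝ≥0) (σ : ℝ) (μ : Measure Ω) : Prop where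
  measurable : ∀ i, Measurable (X i)
  indep : iIndepFun X μ
  mean_zero : ∀ i, ∫ ω, X i ω ∂μ = 0
  variance_eq : ∀ i, ∫ ω, ‖X i ω‖ ^ 2 ∂μ = σ ^ 2
  lintegral_exp_le : ∀ i, ∫⁻ ω, ENNReal.ofReal (Real.exp (‖X i ω‖ ^ 2 / K ^ 2)) ∂μ ≤ 2

namespace IsSubGaussianFamily

variable {X : ι → Ω → ℂ} {K : ℝ≥0} {σ : ℝ}

theorem star (h : IsSubGaussianFamily X K σ μ) :
    IsSubGaussianFamily (fun i ω => (starRingEnd ℂ) (X i ω)) K σ μ where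
  measurable i := Complex.continuous_conj.measurable.comp (h.measurable i)
  indep := h.indep.comp (fun _ z => (starRingEnd ℂ) z) fun _ => Complex.continuous_conj.measurable
  mean_zero i := by rw [integral_conj, h.mean_zero i, map_zero]
  variance_eq i := by simpa using h.variance_eq i
  lintegral_exp_le i := by simpa using h.lintegral_exp_le i

theorem precomp (h : IsSubGaussianFamily X K σ μ) {g : κ → ι} (hg : g.Injective) :
    IsSubGaussianFamily (fun i => X (g i)) K σ μ where
  measurable i := h.measurable (g i)
  indep := h.indep.precomp hg
  mean_zero i := h.mean_zero (g i)
  variance_eq i := h.variance_eq (g i)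
  lintegral_exp_le i := h.lintegral_exp_le (g i)

theorem memLp_two (h : IsSubGaussianFamily X K σ μ) (hK : 0 < K) (i : ι) : MemLp (X i) 2 μ := by
  have hK' : (0 : ℝ) < K := hK
  have hm := h.measurable i
  rw [memLp_two_iff_integrable_sq_norm hm.aestronglyMeasurable]
  have hI : Integrable (fun ω => Real.exp (‖X i ω‖ ^ 2 / K ^ 2)) μ := by
    refine ⟨by fun_prop, ?_⟩
    rw [hasFiniteIntegral_iff_ofReal (Filter.Eventually.of_forall fun ω => (Real.exp_pos _).le)]
    exact (h.lintegral_exp_le i).trans_lt (by simp)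
  refine (hI.const_mul (K ^ 2 : ℝ)).mono' (by fun_prop) (Filter.Eventually.of_forall fun ω => ?_)
  rw [Real.norm_of_nonneg (by positivity), ← div_le_iff₀' (by positivity)]
  linarith [Real.add_one_le_exp (‖X i ω‖ ^ 2 / (K : ℝ) ^ 2)]

variable [IsProbabilityMeasure μ]

theorem hasSubgaussianMGF_re_mul (h : IsSubGaussianFamily X K σ μ) (hK : 0 < K) (i : ι) (a : ℂ) :
    HasSubgaussianMGF (fun ω => (a * X i ω).re) (‖a‖₊ ^ 2 * (2 * K ^ 2)) μ := by
  rcases eq_or_ne a 0 with rfl | ha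
  · simp
  have ha' : 0 < ‖a‖ := norm_pos_iff.mpr ha
  have hm := h.measurable i
  have hI : Integrable (X i) μ := (h.memLp_two hK i).integrable (by norm_num)
  set u : ℂ := a / ‖a‖ with hu
  have hun : ‖u‖ = 1 := by
    rw [hu, norm_div, Complex.norm_real, norm_norm, div_self ha'.ne']
  have h1 : HasSubgaussianMGF (fun ω => (u * X i ω).re) (2 * K ^ 2) μ := by
    refine hasSubgaussianMGF_of_lintegral_exp_sq_le hK
      (Complex.measurable_re.comp (hm.const_mul u)) ?_ ?_
    · have h2 := integral_re (𝕜 := ℂ) (hI.const_mul u)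
      simp only [RCLike.re_to_complex] at h2
      rw [h2, integral_const_mul, h.mean_zero i]
      simp
    · refine (lintegral_mono fun ω => ?_).trans (h.lintegral_exp_le i)
      refine ENNReal.ofReal_le_ofReal (Real.exp_le_exp.mpr ?_)
      refine div_le_div_of_nonneg_right ?_ (by positivity)
      rw [sq_le_sq, abs_norm]
      refine (Complex.abs_re_le_norm _).trans_eq ?_
      rw [norm_mul, hun, one_mul]
  have h2 := h1.const_mul ‖a‖
  convert! h2 using 2 with ω
  have h3 : a = ‖a‖ * u := by
    rw [hu, mul_div_cancel₀]
    exact_mod_cast ha'.ne'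
  conv_lhs => rw [h3, mul_assoc, Complex.re_ofReal_mul]

variable [Fintype ι]

theorem hasSubgaussianMGF_re_sum (h : IsSubGaussianFamily X K σ μ) (hK : 0 < K) (a : ι → ℂ) :
    HasSubgaussianMGF (fun ω => (∑ i, a i * X i ω).re) ((∑ i, ‖a i‖₊ ^ 2) * (2 * K ^ 2)) μ := by
  have h1 : iIndepFun (fun i ω => (a i * X i ω).re) μ :=
    h.indep.comp (fun i z => (a i * z).re)
      fun i => Complex.measurable_re.comp (measurable_id.const_mul (a i))
  have h2 := HasSubgaussianMGF.sum_of_iIndepFun h1 (s := Finset.univ)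
    fun i _ => h.hasSubgaussianMGF_re_mul hK i (a i)
  simpa [Finset.sum_mul] using h2

theorem hasSubgaussianMGF_im_sum (h : IsSubGaussianFamily X K σ μ) (hK : 0 < K) (a : ι → ℂ) :
    HasSubgaussianMGF (fun ω => (∑ i, a i * X i ω).im) ((∑ i, ‖a i‖₊ ^ 2) * (2 * K ^ 2)) μ := by
  have h1 := h.hasSubgaussianMGF_re_sum hK fun i => -Complex.I * a i
  simpa [mul_assoc, ← Finset.mul_sum] using h1

omit [IsProbabilityMeasure μ] in
theorem measurable_sum (h : IsSubGaussianFamily X K σ μ) (a : ι → ℂ) :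
    Measurable fun ω => ∑ i, a i * X i ω :=
  Finset.measurable_sum _ fun i _ => (h.measurable i).const_mul (a i)

/-- A linear combination of sub-Gaussian variables is sub-Gaussian. -/
theorem lintegral_exp_norm_sum_sq_le (h : IsSubGaussianFamily X K σ μ) (hK : 0 < K) (a : ι → ℂ)
    {θ : ℝ} (hθ : 0 ≤ θ) (hθK : 4 * θ * K ^ 2 * ∑ i, ‖a i‖ ^ 2 ≤ 3 / 8) :
    ∫⁻ ω, ENNReal.ofReal (Real.exp (θ * ‖∑ i, a i * X i ω‖ ^ 2)) ∂μ ≤ 2 := by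
  have hm := h.measurable_sum a
  have hre := Complex.measurable_re.comp hm
  have him := Complex.measurable_im.comp hm
  have hc : 2 * θ * (((∑ i, ‖a i‖₊ ^ 2) * (2 * K ^ 2) : ℝ≥0) : ℝ) ≤ 3 / 8 := by
    push_cast
    linarith
  have h1 := lintegral_exp_sq_le (h.hasSubgaussianMGF_re_sum hK a) hre (by positivity) hc
  have h2 := lintegral_exp_sq_le (h.hasSubgaussianMGF_im_sum hK a) him (by positivity) hc
  have hpt : ∀ z : ℂ, ENNReal.ofReal (Real.exp (θ * ‖z‖ ^ 2)) ≤
      2⁻¹ * (ENNReal.ofReal (Real.exp (2 * θ * z.re ^ 2)) +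
        ENNReal.ofReal (Real.exp (2 * θ * z.im ^ 2))) := by
    intro z
    have h3 : (2⁻¹ : ℝ≥0∞) = ENNReal.ofReal (1 / 2) := by
      rw [one_div, ENNReal.ofReal_inv_of_pos (by norm_num)]
      simp
    rw [h3, ← ENNReal.ofReal_add (Real.exp_pos _).le (Real.exp_pos _).le,
      ← ENNReal.ofReal_mul (by norm_num)]
    refine ENNReal.ofReal_le_ofReal ?_
    have h4 := convexOn_exp.2 (Set.mem_univ (2 * θ * z.re ^ 2)) (Set.mem_univ (2 * θ * z.im ^ 2))
      (by norm_num : (0 : ℝ) ≤ 1 / 2) (by norm_num : (0 : ℝ) ≤ 1 / 2) (by norm_num)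
    simp only [smul_eq_mul] at h4
    refine (le_of_eq ?_).trans (h4.trans_eq (by ring))
    rw [Complex.sq_norm, Complex.normSq_apply]
    congr 1
    ring
  calc ∫⁻ ω, ENNReal.ofReal (Real.exp (θ * ‖∑ i, a i * X i ω‖ ^ 2)) ∂μ
      ≤ ∫⁻ ω, 2⁻¹ * (ENNReal.ofReal (Real.exp (2 * θ * (∑ i, a i * X i ω).re ^ 2)) +
        ENNReal.ofReal (Real.exp (2 * θ * (∑ i, a i * X i ω).im ^ 2))) ∂μ :=
        lintegral_mono fun ω => hpt _
    _ = 2⁻¹ * (∫⁻ ω, ENNReal.ofReal (Real.exp (2 * θ * (∑ i, a i * X i ω).re ^ 2)) ∂μ +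
        ∫⁻ ω, ENNReal.ofReal (Real.exp (2 * θ * (∑ i, a i * X i ω).im ^ 2)) ∂μ) := by
        rw [lintegral_const_mul' _ _ (by simp), lintegral_add_left]
        exact ((hre.pow_const 2).const_mul (2 * θ)).exp.ennreal_ofReal
    _ ≤ 2⁻¹ * (2 + 2) := by gcongr
    _ = 2 := by
        rw [← two_mul, ← mul_assoc, ENNReal.inv_mul_cancel (by simp) (by simp), one_mul]

/-- The exponential moment of the modulus of a linear combination is reduced to the moment
generating functions of its real and imaginary parts through
`exp (t |z|) ≤ (exp (2t |re z|) + exp (2t |im z|)) / 2`. -/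
theorem lintegral_exp_norm_sum_le (h : IsSubGaussianFamily X K σ μ) (hK : 0 < K) (a : ι → ℂ)
    {t : ℝ} (ht : 0 ≤ t) : ∫⁻ ω, ENNReal.ofReal (Real.exp (t * ‖∑ i, a i * X i ω‖)) ∂μ ≤
      2 * ENNReal.ofReal (Real.exp (4 * K ^ 2 * t ^ 2 * ∑ i, ‖a i‖ ^ 2)) := by
  have hm := h.measurable_sum a
  have hre : Measurable fun ω => (∑ i, a i * X i ω).re := Complex.measurable_re.comp hm
  have him : Measurable fun ω => (∑ i, a i * X i ω).im := Complex.measurable_im.comp hm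
  have hc : ∀ s : ℝ, s ^ 2 = (2 * t) ^ 2 →
      (((∑ i, ‖a i‖₊ ^ 2) * (2 * K ^ 2) : ℝ≥0) : ℝ) * s ^ 2 / 2 =
        4 * K ^ 2 * t ^ 2 * ∑ i, ‖a i‖ ^ 2 := by
    intro s hs
    rw [hs]
    push_cast
    ring
  have h1 := lintegral_ofReal_exp_mul_le (h.hasSubgaussianMGF_re_sum hK a) (2 * t)
  have h2 := lintegral_ofReal_exp_mul_le (h.hasSubgaussianMGF_re_sum hK a) (-(2 * t))
  have h3 := lintegral_ofReal_exp_mul_le (h.hasSubgaussianMGF_im_sum hK a) (2 * t)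
  have h4 := lintegral_ofReal_exp_mul_le (h.hasSubgaussianMGF_im_sum hK a) (-(2 * t))
  rw [hc _ rfl] at h1 h3
  rw [hc _ (by ring)] at h2 h4
  set A : ℝ≥0∞ := ENNReal.ofReal (Real.exp (4 * K ^ 2 * t ^ 2 * ∑ i, ‖a i‖ ^ 2)) with hA
  have habs : ∀ x : ℝ, Real.exp (2 * t * |x|) ≤ Real.exp (2 * t * x) + Real.exp (-(2 * t) * x) := by
    intro x
    rcases abs_choice x with hx | hx <;> rw [hx]
    · linarith [Real.exp_pos (-(2 * t) * x)]
    · rw [mul_neg, ← neg_mul]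
      linarith [Real.exp_pos (2 * t * x)]
  have hpt : ∀ z : ℂ, ENNReal.ofReal (Real.exp (t * ‖z‖)) ≤
      2⁻¹ * (ENNReal.ofReal (Real.exp (2 * t * z.re)) + ENNReal.ofReal (Real.exp (-(2 * t) * z.re)) +
        ENNReal.ofReal (Real.exp (2 * t * z.im)) +
          ENNReal.ofReal (Real.exp (-(2 * t) * z.im))) := by
    intro z
    have h5 : (2⁻¹ : ℝ≥0∞) = ENNReal.ofReal (1 / 2) := by
      rw [one_div, ENNReal.ofReal_inv_of_pos (by norm_num)]
      simp
    rw [h5, ← ENNReal.ofReal_add (by positivity) (by positivity),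
      ← ENNReal.ofReal_add (by positivity) (by positivity),
      ← ENNReal.ofReal_add (by positivity) (by positivity), ← ENNReal.ofReal_mul (by norm_num)]
    refine ENNReal.ofReal_le_ofReal ?_
    have h6 := convexOn_exp.2 (Set.mem_univ (2 * t * |z.re|)) (Set.mem_univ (2 * t * |z.im|))
      (by norm_num : (0 : ℝ) ≤ 1 / 2) (by norm_num : (0 : ℝ) ≤ 1 / 2) (by norm_num)
    simp only [smul_eq_mul] at h6
    have h7 : t * ‖z‖ ≤ 1 / 2 * (2 * t * |z.re|) + 1 / 2 * (2 * t * |z.im|) := by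
      nlinarith [Complex.norm_le_abs_re_add_abs_im z]
    have h8 := Real.exp_le_exp.mpr h7
    linarith [habs z.re, habs z.im]
  calc ∫⁻ ω, ENNReal.ofReal (Real.exp (t * ‖∑ i, a i * X i ω‖)) ∂μ
      ≤ ∫⁻ ω, 2⁻¹ * (ENNReal.ofReal (Real.exp (2 * t * (∑ i, a i * X i ω).re)) +
          ENNReal.ofReal (Real.exp (-(2 * t) * (∑ i, a i * X i ω).re)) +
          ENNReal.ofReal (Real.exp (2 * t * (∑ i, a i * X i ω).im)) +
          ENNReal.ofReal (Real.exp (-(2 * t) * (∑ i, a i * X i ω).im))) ∂μ :=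
        lintegral_mono fun ω => hpt _
    _ = 2⁻¹ * (∫⁻ ω, ENNReal.ofReal (Real.exp (2 * t * (∑ i, a i * X i ω).re)) ∂μ +
          ∫⁻ ω, ENNReal.ofReal (Real.exp (-(2 * t) * (∑ i, a i * X i ω).re)) ∂μ +
          ∫⁻ ω, ENNReal.ofReal (Real.exp (2 * t * (∑ i, a i * X i ω).im)) ∂μ +
          ∫⁻ ω, ENNReal.ofReal (Real.exp (-(2 * t) * (∑ i, a i * X i ω).im)) ∂μ) := by
        rw [lintegral_const_mul' _ _ (by simp), lintegral_add_right _ (by fun_prop),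
          lintegral_add_right _ (by fun_prop), lintegral_add_right _ (by fun_prop)]
    _ ≤ 2⁻¹ * (A + A + A + A) := by gcongr
    _ = 2 * A := by
        rw [show A + A + A + A = 2 * (2 * A) by ring, ← mul_assoc,
          ENNReal.inv_mul_cancel (by simp) (by simp), one_mul]

omit [IsProbabilityMeasure μ] in
theorem integral_norm_sum_sq (h : IsSubGaussianFamily X K σ μ) (hK : 0 < K) (a : ι → ℂ) :
    ∫ ω, ‖∑ i, a i * X i ω‖ ^ 2 ∂μ = σ ^ 2 * ∑ i, ‖a i‖ ^ 2 := by
  classical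
  have hI : ∀ i, MemLp (X i) 2 μ := h.memLp_two hK
  have hIc : ∀ i, MemLp (fun ω => (starRingEnd ℂ) (X i ω)) 2 μ := h.star.memLp_two hK
  have hij : ∀ i j, Integrable (fun ω => X i ω * (starRingEnd ℂ) (X j ω)) μ :=
    fun i j => (hI i).integrable_mul (hIc j)
  have hval : ∀ i j, ∫ ω, X i ω * (starRingEnd ℂ) (X j ω) ∂μ =
      if i = j then ((σ ^ 2 : ℝ) : ℂ) else 0 := by
    intro i j
    split_ifs with hne
    · subst hne
      rw [← h.variance_eq i, ← integral_complex_ofReal]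
      refine integral_congr_ae (Filter.Eventually.of_forall fun ω => ?_)
      simp [Complex.mul_conj, Complex.normSq_eq_norm_sq]
    · have hind : IndepFun (X i) (fun ω => (starRingEnd ℂ) (X j ω)) μ :=
        (h.indep.indepFun hne).comp (φ := id) (ψ := fun z => (starRingEnd ℂ) z) measurable_id
          Complex.continuous_conj.measurable
      rw [hind.integral_fun_mul_eq_mul_integral (h.measurable i).aestronglyMeasurable
        (h.star.measurable j).aestronglyMeasurable, h.mean_zero i, zero_mul]
  have hexp : ∀ ω, ((‖∑ i, a i * X i ω‖ ^ 2 : ℝ) : ℂ) =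
      ∑ i, ∑ j, (a i * (starRingEnd ℂ) (a j)) * (X i ω * (starRingEnd ℂ) (X j ω)) := by
    intro ω
    rw [← Complex.normSq_eq_norm_sq, ← Complex.mul_conj, map_sum, Finset.sum_mul_sum]
    refine Finset.sum_congr rfl fun i _ => Finset.sum_congr rfl fun j _ => ?_
    rw [map_mul]
    ring
  have hC : ((∫ ω, ‖∑ i, a i * X i ω‖ ^ 2 ∂μ : ℝ) : ℂ) = ((σ ^ 2 * ∑ i, ‖a i‖ ^ 2 : ℝ) : ℂ) := by
    rw [← integral_complex_ofReal]
    simp only [hexp]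
    rw [integral_finsetSum _ fun i _ => integrable_finsetSum _ fun j _ => (hij i j).const_mul _]
    have : ∀ i, ∫ ω, ∑ j, (a i * (starRingEnd ℂ) (a j)) * (X i ω * (starRingEnd ℂ) (X j ω)) ∂μ =
        ((σ ^ 2 * ‖a i‖ ^ 2 : ℝ) : ℂ) := by
      intro i
      rw [integral_finsetSum _ fun j _ => (hij i j).const_mul _]
      simp only [integral_const_mul, hval, mul_ite, mul_zero, Finset.sum_ite_eq,
        Finset.mem_univ, if_true]
      rw [Complex.mul_conj, Complex.normSq_eq_norm_sq]
      push_cast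
      ring
    simp only [this, Finset.mul_sum]
    push_cast
    rfl
  exact_mod_cast hC

omit [IsProbabilityMeasure μ] in
theorem lintegral_norm_sum_sq (h : IsSubGaussianFamily X K σ μ) (hK : 0 < K) (a : ι → ℂ) :
    ∫⁻ ω, ENNReal.ofReal (‖∑ i, a i * X i ω‖ ^ 2) ∂μ =
      ENNReal.ofReal (σ ^ 2 * ∑ i, ‖a i‖ ^ 2) := by
  rw [← h.integral_norm_sum_sq hK a]
  refine (ofReal_integral_eq_lintegral_ofReal ?_
    (Filter.Eventually.of_forall fun ω => by positivity)).symm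
  rw [← memLp_two_iff_integrable_sq_norm (h.measurable_sum a).aestronglyMeasurable]
  exact memLp_finsetSum _ fun i _ => (h.memLp_two hK i).const_mul (a i)

end IsSubGaussianFamily

end

/-! ### Bilinear forms in sub-Gaussian variables -/

section

variable {Ω : Type*} [MeasurableSpace Ω] {μ : Measure Ω} [IsProbabilityMeasure μ] {ι κ : Type*}

/-- Conditioning on one of two independent variables: the outer integral is over the variable that
is frozen. -/
theorem lintegral_comp_of_indepFun {𝓤 𝓥 : Type*} [MeasurableSpace 𝓤] [MeasurableSpace 𝓥]
    {U : Ω → 𝓤} {V : Ω → 𝓥} (hU : Measurable U) (hV : Measurable V) (h : IndepFun U V μ)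
    {f : 𝓤 × 𝓥 → ℝ≥0∞} (hf : Measurable f) :
    ∫⁻ ω, f (U ω, V ω) ∂μ = ∫⁻ ω', ∫⁻ ω, f (U ω, V ω') ∂μ ∂μ := by
  have h1 := (indepFun_iff_map_prod_eq_prod_map_map hU.aemeasurable hV.aemeasurable).mp h
  have : IsProbabilityMeasure (μ.map U) := Measure.isProbabilityMeasure_map hU.aemeasurable
  have : IsProbabilityMeasure (μ.map V) := Measure.isProbabilityMeasure_map hV.aemeasurable
  rw [← lintegral_map hf (hU.prodMk hV), h1, lintegral_prod_symm' _ hf,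
    lintegral_map hf.lintegral_prod_left' hV]
  refine lintegral_congr fun ω' => ?_
  rw [lintegral_map (by fun_prop) hU]

/-- The bilinear form `∑ᵢⱼ uᵢ Jᵢⱼ vⱼ`. -/
def bilinearForm [Fintype ι] [Fintype κ] (J : ι → κ → ℂ) (u : ι → ℂ) (v : κ → ℂ) : ℂ :=
  ∑ i, (∑ j, J i j * v j) * u i

theorem bilinearForm_smul [Fintype ι] [Fintype κ] (a : ℂ) (J : ι → κ → ℂ) (u : ι → ℂ)
    (v : κ → ℂ) : bilinearForm (fun i j => a * J i j) u v = a * bilinearForm J u v := by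
  simp only [bilinearForm, Finset.mul_sum, Finset.sum_mul, mul_assoc]

theorem measurable_bilinearForm [Fintype ι] [Fintype κ] (J : ι → κ → ℂ) :
    Measurable fun p : (ι → ℂ) × (κ → ℂ) => bilinearForm J p.1 p.2 := by
  unfold bilinearForm
  fun_prop

namespace IsSubGaussianFamily

variable {U : ι → Ω → ℂ} {V : κ → Ω → ℂ} {K : ℝ≥0} {σ : ℝ} [Fintype ι] [Fintype κ]

/-- The squared norm of `J V` has an exponential moment. The coordinates of `J V` are dependent;
Jensen's inequality, with weights proportional to the squared norms of the rows of `J`, reduces the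
bound to a single coordinate. -/
theorem lintegral_exp_sum_norm_sq_le (h : IsSubGaussianFamily V K σ μ) (hK : 0 < K)
    (J : ι → κ → ℂ) {θ : ℝ} (hθ : 0 ≤ θ)
    (hθK : 4 * θ * K ^ 2 * ∑ i, ∑ j, ‖J i j‖ ^ 2 ≤ 3 / 8) :
    ∫⁻ ω, ENNReal.ofReal (Real.exp (θ * ∑ i, ‖∑ j, J i j * V j ω‖ ^ 2)) ∂μ ≤ 2 := by
  set r : ι → ℝ := fun i => ∑ j, ‖J i j‖ ^ 2 with hr
  set S : ℝ := ∑ i, r i with hS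
  have hr0 : ∀ i, 0 ≤ r i := fun i => Finset.sum_nonneg fun j _ => by positivity
  have hS0 : 0 ≤ S := Finset.sum_nonneg fun i _ => hr0 i
  have hrow : ∀ i, r i = 0 → ∀ ω, ∑ j, J i j * V j ω = 0 := by
    intro i hi ω
    rw [hr, Finset.sum_eq_zero_iff_of_nonneg fun j _ => by positivity] at hi
    refine Finset.sum_eq_zero fun j hj => ?_
    have := hi j hj
    simp only [ne_eq, OfNat.ofNat_ne_zero, not_false_eq_true, pow_eq_zero_iff, norm_eq_zero] at this
    rw [this, zero_mul]
  rcases hS0.eq_or_lt with hS1 | hS1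
  · have hall : ∀ i, r i = 0 := fun i =>
      (Finset.sum_eq_zero_iff_of_nonneg fun i _ => hr0 i).mp hS1.symm i (Finset.mem_univ i)
    have : ∀ ω, ∑ i, ‖∑ j, J i j * V j ω‖ ^ 2 = 0 := by
      intro ω
      refine Finset.sum_eq_zero fun i _ => ?_
      rw [hrow i (hall i) ω]
      simp
    simp only [this]
    simp
  have hsplit : ∀ ω, θ * ∑ i, ‖∑ j, J i j * V j ω‖ ^ 2 =
      ∑ i, (r i / S) • (θ * S / r i * ‖∑ j, J i j * V j ω‖ ^ 2) := by
    intro ω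
    rw [Finset.mul_sum]
    refine Finset.sum_congr rfl fun i _ => ?_
    rw [smul_eq_mul]
    rcases eq_or_ne (r i) 0 with hi | hi
    · rw [hrow i hi ω]
      simp
    · field_simp
  have hw : ∑ i, r i / S = 1 := by
    rw [← Finset.sum_div, ← hS, div_self hS1.ne']
  have hmeas : ∀ i, Measurable fun ω =>
      ENNReal.ofReal (Real.exp (θ * S / r i * ‖∑ j, J i j * V j ω‖ ^ 2)) := fun i =>
    (((h.measurable_sum (J i)).norm.pow_const 2).const_mul _).exp.ennreal_ofReal
  have hone : ∀ i, ∫⁻ ω,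
      ENNReal.ofReal (Real.exp (θ * S / r i * ‖∑ j, J i j * V j ω‖ ^ 2)) ∂μ ≤ 2 := by
    intro i
    refine h.lintegral_exp_norm_sum_sq_le hK (J i)
      (div_nonneg (mul_nonneg hθ hS0) (hr0 i)) (le_trans ?_ hθK)
    rcases eq_or_ne (r i) 0 with hi | hi
    · rw [hi, div_zero, mul_zero, zero_mul, zero_mul]
      positivity
    · refine le_of_eq ?_
      change 4 * (θ * S / r i) * K ^ 2 * r i = _
      field_simp
  calc ∫⁻ ω, ENNReal.ofReal (Real.exp (θ * ∑ i, ‖∑ j, J i j * V j ω‖ ^ 2)) ∂μ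
      ≤ ∫⁻ ω, ∑ i, ENNReal.ofReal (r i / S) *
          ENNReal.ofReal (Real.exp (θ * S / r i * ‖∑ j, J i j * V j ω‖ ^ 2)) ∂μ := by
        refine lintegral_mono fun ω => ?_
        have hw0 : ∀ i, 0 ≤ r i / S := fun i => div_nonneg (hr0 i) hS0
        have h1 : ∀ i, ENNReal.ofReal (r i / S) *
            ENNReal.ofReal (Real.exp (θ * S / r i * ‖∑ j, J i j * V j ω‖ ^ 2)) =
            ENNReal.ofReal ((r i / S) • Real.exp (θ * S / r i * ‖∑ j, J i j * V j ω‖ ^ 2)) :=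
          fun i => by rw [smul_eq_mul, ENNReal.ofReal_mul (hw0 i)]
        simp only [h1]
        rw [← ENNReal.ofReal_sum_of_nonneg fun i _ =>
          smul_nonneg (hw0 i) (Real.exp_pos _).le, hsplit ω]
        exact ENNReal.ofReal_le_ofReal
          (convexOn_exp.map_sum_le (fun i _ => hw0 i) hw fun i _ => Set.mem_univ _)
    _ = ∑ i, ENNReal.ofReal (r i / S) *
          ∫⁻ ω, ENNReal.ofReal (Real.exp (θ * S / r i * ‖∑ j, J i j * V j ω‖ ^ 2)) ∂μ := by
        rw [lintegral_finsetSum _ fun i _ => (hmeas i).const_mul _]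
        exact Finset.sum_congr rfl fun i _ => lintegral_const_mul _ (hmeas i)
    _ ≤ ∑ i, ENNReal.ofReal (r i / S) * 2 := by
        gcongr with i
        exact hone i
    _ = 2 := by
        rw [← Finset.sum_mul, ← ENNReal.ofReal_sum_of_nonneg
          fun i _ => div_nonneg (hr0 i) hS0, hw, ENNReal.ofReal_one, one_mul]

omit [IsProbabilityMeasure μ] [Fintype ι] in
theorem measurable_pi (h : IsSubGaussianFamily U K σ μ) : Measurable fun ω i => U i ω :=
  measurable_pi_iff.mpr h.measurable

/-- Conditionally on `V`, the bilinear form is sub-Gaussian with variance proxy `‖J V‖²`; the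
exponential moment of `‖J V‖²` then bounds that of the modulus of the form. -/
theorem lintegral_exp_norm_bilinearForm_le (hU : IsSubGaussianFamily U K σ μ)
    (hV : IsSubGaussianFamily V K σ μ) (hK : 0 < K)
    (hUV : IndepFun (fun ω i => U i ω) (fun ω j => V j ω) μ) (J : ι → κ → ℂ) {t : ℝ} (ht : 0 ≤ t)
    (htK : 16 * K ^ 4 * t ^ 2 * ∑ i, ∑ j, ‖J i j‖ ^ 2 ≤ 3 / 8) :
    ∫⁻ ω, ENNReal.ofReal
      (Real.exp (t * ‖bilinearForm J (fun i => U i ω) (fun j => V j ω)‖)) ∂μ ≤ 4 := by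
  have hmeas := measurable_bilinearForm J
  rw [lintegral_comp_of_indepFun (f := fun p : (ι → ℂ) × (κ → ℂ) =>
    ENNReal.ofReal (Real.exp (t * ‖bilinearForm J p.1 p.2‖))) hU.measurable_pi hV.measurable_pi hUV
    (by fun_prop)]
  calc ∫⁻ ω', ∫⁻ ω, ENNReal.ofReal
        (Real.exp (t * ‖bilinearForm J (fun i => U i ω) (fun j => V j ω')‖)) ∂μ ∂μ
      ≤ ∫⁻ ω', 2 * ENNReal.ofReal
          (Real.exp (4 * K ^ 2 * t ^ 2 * ∑ i, ‖∑ j, J i j * V j ω'‖ ^ 2)) ∂μ :=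
        lintegral_mono fun ω' => hU.lintegral_exp_norm_sum_le hK _ ht
    _ = 2 * ∫⁻ ω', ENNReal.ofReal
          (Real.exp (4 * K ^ 2 * t ^ 2 * ∑ i, ‖∑ j, J i j * V j ω'‖ ^ 2)) ∂μ :=
        lintegral_const_mul' _ _ (by simp)
    _ ≤ 2 * 2 := by
        gcongr
        exact hV.lintegral_exp_sum_norm_sq_le hK J (by positivity)
          (le_trans (le_of_eq (by ring)) htK)
    _ = 4 := by norm_num

theorem lintegral_norm_sq_bilinearForm (hU : IsSubGaussianFamily U K σ μ)
    (hV : IsSubGaussianFamily V K σ μ) (hK : 0 < K)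
    (hUV : IndepFun (fun ω i => U i ω) (fun ω j => V j ω) μ) (J : ι → κ → ℂ) :
    ∫⁻ ω, ENNReal.ofReal (‖bilinearForm J (fun i => U i ω) (fun j => V j ω)‖ ^ 2) ∂μ =
      ENNReal.ofReal (σ ^ 4 * ∑ i, ∑ j, ‖J i j‖ ^ 2) := by
  have hmeas := measurable_bilinearForm J
  rw [lintegral_comp_of_indepFun (f := fun p : (ι → ℂ) × (κ → ℂ) =>
    ENNReal.ofReal (‖bilinearForm J p.1 p.2‖ ^ 2)) hU.measurable_pi hV.measurable_pi hUV
    (by fun_prop)]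
  calc ∫⁻ ω', ∫⁻ ω, ENNReal.ofReal
        (‖bilinearForm J (fun i => U i ω) (fun j => V j ω')‖ ^ 2) ∂μ ∂μ
      = ∫⁻ ω', ∑ i, ENNReal.ofReal (σ ^ 2) * ENNReal.ofReal (‖∑ j, J i j * V j ω'‖ ^ 2) ∂μ := by
        refine lintegral_congr fun ω' => ?_
        refine (hU.lintegral_norm_sum_sq hK _).trans ?_
        rw [← Finset.mul_sum, ← ENNReal.ofReal_sum_of_nonneg fun i _ => by positivity,
          ← ENNReal.ofReal_mul (by positivity)]
    _ = ∑ i, ENNReal.ofReal (σ ^ 2) * ENNReal.ofReal (σ ^ 2 * ∑ j, ‖J i j‖ ^ 2) := by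
        have hm : ∀ i, Measurable fun ω => ENNReal.ofReal (‖∑ j, J i j * V j ω‖ ^ 2) := fun i =>
          ((hV.measurable_sum (J i)).norm.pow_const 2).ennreal_ofReal
        rw [lintegral_finsetSum _ fun i _ => (hm i).const_mul _]
        refine Finset.sum_congr rfl fun i _ => ?_
        rw [lintegral_const_mul _ (hm i), hV.lintegral_norm_sum_sq hK]
    _ = ENNReal.ofReal (σ ^ 4 * ∑ i, ∑ j, ‖J i j‖ ^ 2) := by
        rw [← Finset.mul_sum, ← ENNReal.ofReal_sum_of_nonneg fun i _ => by positivity,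
          ← ENNReal.ofReal_mul (by positivity), ← Finset.mul_sum]
        congr 1
        ring

end IsSubGaussianFamily

/-! ### Tails of averages of independent nonnegative variables -/

/-- A nonnegative variable with a given second moment and an exponential moment has a mean bounded
away from `0`, hence a Laplace transform strictly below `1` at an explicit point. -/
theorem integral_exp_neg_mul_le {X : Ω → ℝ} (hX : Measurable X) (hX0 : ∀ ω, 0 ≤ X ω) {t v : ℝ}
    (ht : 0 < t) (hv : 0 < v)
    (hexp : ∫⁻ ω, ENNReal.ofReal (Real.exp (t * X ω)) ∂μ ≤ 4)
    (hsq : ∫⁻ ω, ENNReal.ofReal (X ω ^ 2) ∂μ = ENNReal.ofReal v) :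
    ∫ ω, Real.exp (-(v * t ^ 3 / 96) * X ω) ∂μ ≤
      Real.exp (-((v ^ 2 * t ^ 3 / 96) ^ 2 / (2 * v))) := by
  have hIexp : Integrable (fun ω => Real.exp (t * X ω)) μ := by
    refine ⟨by fun_prop, ?_⟩
    rw [hasFiniteIntegral_iff_ofReal (Filter.Eventually.of_forall fun ω => (Real.exp_pos _).le)]
    exact hexp.trans_lt (by simp)
  have hexp' : ∫ ω, Real.exp (t * X ω) ∂μ ≤ 4 := by
    rw [integral_eq_lintegral_of_nonneg_ae
      (Filter.Eventually.of_forall fun ω => (Real.exp_pos _).le) (by fun_prop)]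
    exact ENNReal.toReal_le_of_le_ofReal (by norm_num) (by simpa using hexp)
  have hIsq : Integrable (fun ω => X ω ^ 2) μ := by
    refine ⟨by fun_prop, ?_⟩
    rw [hasFiniteIntegral_iff_ofReal (Filter.Eventually.of_forall fun ω => sq_nonneg _), hsq]
    exact ENNReal.ofReal_lt_top
  have hsq' : ∫ ω, X ω ^ 2 ∂μ = v := by
    rw [integral_eq_lintegral_of_nonneg_ae
      (Filter.Eventually.of_forall fun ω => sq_nonneg _) (by fun_prop), hsq,
      ENNReal.toReal_ofReal hv.le]
  have hIX : Integrable X μ := by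
    refine (hIsq.add (integrable_const (1 : ℝ))).mono' (by fun_prop)
      (Filter.Eventually.of_forall fun ω => ?_)
    rw [Real.norm_of_nonneg (hX0 ω)]
    simp only [Pi.add_apply]
    nlinarith [sq_nonneg (X ω - 1), hX0 ω]
  set η : ℝ := v ^ 2 * t ^ 3 / 96 with hη
  have hη0 : 0 < η := by positivity
  -- `x² ≤ τ x + x³ / τ` at the level `τ = 48 / (t³ v)` where the cubic term costs half of `v`.
  have hmean : η ≤ ∫ ω, X ω ∂μ := by
    set τ : ℝ := 48 / (t ^ 3 * v) with hτ
    have hτ0 : 0 < τ := by positivity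
    have hpt : ∀ x : ℝ, 0 ≤ x → x ^ 2 ≤ τ * x + v / 8 * Real.exp (t * x) := by
      intro x hx
      have h1 : (t * x) ^ 3 / 6 ≤ Real.exp (t * x) := by
        have := Real.pow_div_factorial_le_exp (t * x) (by positivity) 3
        simpa [Nat.factorial] using this
      have h2 : v / 8 * ((t * x) ^ 3 / 6) = x ^ 3 / τ := by
        rw [hτ]
        field_simp
        ring
      have h3 : x ^ 2 ≤ τ * x + x ^ 3 / τ := by
        have h4 : τ * x + x ^ 3 / τ - x ^ 2 = x / τ * (τ ^ 2 + x ^ 2 - τ * x) := by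
          field_simp
        have h5 : 0 ≤ τ ^ 2 + x ^ 2 - τ * x := by nlinarith [sq_nonneg (τ - x)]
        have : 0 ≤ x / τ * (τ ^ 2 + x ^ 2 - τ * x) := by positivity
        linarith
      have h6 : v / 8 * ((t * x) ^ 3 / 6) ≤ v / 8 * Real.exp (t * x) := by gcongr
      linarith
    have h7 : v ≤ τ * ∫ ω, X ω ∂μ + v / 8 * ∫ ω, Real.exp (t * X ω) ∂μ := by
      rw [← integral_const_mul, ← integral_const_mul,
        ← integral_add (hIX.const_mul _) (hIexp.const_mul _)]
      conv_lhs => rw [← hsq']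
      exact integral_mono hIsq ((hIX.const_mul _).add (hIexp.const_mul _))
        fun ω => hpt _ (hX0 ω)
    have h8 : v / 2 ≤ τ * ∫ ω, X ω ∂μ := by nlinarith
    have h9 : τ * η = v / 2 := by
      rw [hτ, hη]
      field_simp
      ring
    rw [← h9] at h8
    exact le_of_mul_le_mul_left h8 hτ0
  set s : ℝ := v * t ^ 3 / 96 with hs
  have hs0 : 0 < s := by positivity
  have hpt : ∀ x : ℝ, 0 ≤ x → Real.exp (-s * x) ≤ 1 - s * x + s ^ 2 / 2 * x ^ 2 := by
    intro x hx
    have h1 := Real.quadratic_le_exp_of_nonneg (x := s * x) (by positivity)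
    have h2 : Real.exp (-s * x) * Real.exp (s * x) = 1 := by
      rw [← Real.exp_add]
      simp
    have h3 := Real.exp_pos (-s * x)
    have hy : 0 ≤ s * x := by positivity
    set y := s * x
    have h4 : Real.exp (-s * x) * (1 + y + y ^ 2 / 2) ≤ 1 := by nlinarith
    have h5 : 1 ≤ (1 - y + y ^ 2 / 2) * (1 + y + y ^ 2 / 2) := by nlinarith [sq_nonneg (y ^ 2)]
    have h6 : 0 < 1 + y + y ^ 2 / 2 := by positivity
    have h7 : Real.exp (-s * x) ≤ 1 - y + y ^ 2 / 2 :=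
      le_of_mul_le_mul_right (h4.trans h5) h6
    refine h7.trans_eq ?_
    simp only [y]
    ring
  calc ∫ ω, Real.exp (-s * X ω) ∂μ
      ≤ ∫ ω, (1 - s * X ω + s ^ 2 / 2 * X ω ^ 2) ∂μ := by
        refine integral_mono_of_nonneg (Filter.Eventually.of_forall fun ω => (Real.exp_pos _).le)
          (((integrable_const _).sub (hIX.const_mul s)).add (hIsq.const_mul _))
          (Filter.Eventually.of_forall fun ω => hpt _ (hX0 ω))
    _ = 1 - s * ∫ ω, X ω ∂μ + s ^ 2 / 2 * v := by
        have hI1 : Integrable (fun ω => 1 - s * X ω) μ :=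
          (integrable_const _).sub (hIX.const_mul s)
        rw [integral_add hI1 (hIsq.const_mul _),
          integral_sub (integrable_const _) (hIX.const_mul s), integral_const_mul,
          integral_const_mul, hsq']
        simp
    _ ≤ 1 - s * η + s ^ 2 / 2 * v := by gcongr
    _ = -(η ^ 2 / (2 * v)) + 1 := by
        have : η = s * v := by rw [hη, hs]; ring
        rw [this]
        field_simp
        ring
    _ ≤ Real.exp (-(η ^ 2 / (2 * v))) := Real.add_one_le_exp _

/-- Chernoff's bound for the lower tail of a sum, from a bound on the Laplace transform. -/
theorem measure_sum_le_le_exp {n : ℕ} {X : Fin n → Ω → ℝ} (hX : ∀ p, Measurable (X p))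
    (hX0 : ∀ p ω, 0 ≤ X p ω) (hind : iIndepFun X μ) {s r ε : ℝ} (hs : 0 ≤ s)
    (hmgf : ∀ p, ∫ ω, Real.exp (-s * X p ω) ∂μ ≤ Real.exp (-r)) :
    μ.real {ω | ∑ p, X p ω ≤ n * ε} ≤ Real.exp (-(r - s * ε) * n) := by
  have h0 : ∀ ω, 0 ≤ ∑ p, X p ω := fun ω => Finset.sum_nonneg fun p _ => hX0 p ω
  have hm : Measurable fun ω => ∑ p, X p ω := Finset.measurable_sum _ fun p _ => hX p
  have hI : Integrable (fun ω => Real.exp (-s * ∑ p, X p ω)) μ := by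
    refine (integrable_const (1 : ℝ)).mono' (by fun_prop) (Filter.Eventually.of_forall fun ω => ?_)
    rw [Real.norm_of_nonneg (Real.exp_pos _).le, Real.exp_le_one_iff]
    nlinarith [h0 ω]
  refine (measure_le_le_exp_mul_mgf (n * ε) (neg_nonpos.mpr hs) hI).trans ?_
  have h1 : mgf (fun ω => ∑ p, X p ω) μ (-s) ≤ Real.exp (-r) ^ n := by
    have h2 := hind.mgf_sum (t := -s) hX Finset.univ
    have h3 : (∑ p, X p) = fun ω => ∑ p, X p ω := by
      ext ω
      simp
    rw [← h3, h2]
    refine (Finset.prod_le_prod (fun p _ => mgf_nonneg) fun p _ => hmgf p).trans_eq ?_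
    simp
  calc _ ≤ Real.exp (- -s * (n * ε)) * Real.exp (-r) ^ n := by gcongr
    _ = _ := by
      rw [← Real.exp_nat_mul, ← Real.exp_add]
      congr 1
      ring

/-- Chernoff's bound for the upper tail of a sum, from a bound on an exponential moment. -/
theorem measure_le_sum_le_exp {n : ℕ} {X : Fin n → Ω → ℝ} (hX : ∀ p, Measurable (X p))
    (hind : iIndepFun X μ) {t r ε : ℝ} (ht : 0 ≤ t)
    (hexp : ∀ p, ∫⁻ ω, ENNReal.ofReal (Real.exp (t * X p ω)) ∂μ ≤ ENNReal.ofReal (Real.exp r)) :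
    μ.real {ω | n * ε ≤ ∑ p, X p ω} ≤ Real.exp (-(t * ε - r) * n) := by
  have hIp : ∀ p, Integrable (fun ω => Real.exp (t * X p ω)) μ := by
    intro p
    have := hX p
    refine ⟨by fun_prop, ?_⟩
    rw [hasFiniteIntegral_iff_ofReal (Filter.Eventually.of_forall fun ω => (Real.exp_pos _).le)]
    exact (hexp p).trans_lt ENNReal.ofReal_lt_top
  have hI : Integrable (fun ω => Real.exp (t * ∑ p, X p ω)) μ := by
    have := hind.integrable_exp_mul_sum (s := Finset.univ) (t := t) hX fun p _ => hIp p
    simpa using this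
  refine (measure_ge_le_exp_mul_mgf (n * ε) ht hI).trans ?_
  have h1 : mgf (fun ω => ∑ p, X p ω) μ t ≤ Real.exp r ^ n := by
    have h2 := hind.mgf_sum (t := t) hX Finset.univ
    have h3 : (∑ p, X p) = fun ω => ∑ p, X p ω := by
      ext ω
      simp
    rw [← h3, h2]
    have h4 : ∀ p, mgf (X p) μ t ≤ Real.exp r := by
      intro p
      have := hX p
      rw [mgf, integral_eq_lintegral_of_nonneg_ae
        (Filter.Eventually.of_forall fun ω => (Real.exp_pos _).le) (by fun_prop)]
      exact ENNReal.toReal_le_of_le_ofReal (Real.exp_pos _).le (hexp p)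
    refine (Finset.prod_le_prod (fun p _ => mgf_nonneg) fun p _ => h4 p).trans_eq ?_
    simp
  calc _ ≤ Real.exp (-t * (n * ε)) * Real.exp r ^ n := by gcongr
    _ = _ := by
      rw [← Real.exp_nat_mul, ← Real.exp_add]
      congr 1
      ring

end

/-! ### Independent copies of the bilinear form -/

section

variable {Ω : Type*} [MeasurableSpace Ω] {μ : Measure Ω} [IsProbabilityMeasure μ] {ι κ : Type*}

/-- The rows of a doubly indexed family of independent variables are independent vectors. -/
theorem iIndepFun_curry {𝓧 : Type*} [MeasurableSpace 𝓧] {X : ι × κ → Ω → 𝓧}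
    (hX : ∀ i, Measurable (X i)) (h : iIndepFun X μ) :
    iIndepFun (fun i ω j => X (i, j) ω) μ := by
  have hrow : ∀ i, μ.map (fun ω j => X (i, j) ω) =
      Measure.infinitePi fun j => μ.map (X (i, j)) := fun i =>
    (iIndepFun_iff_map_fun_eq_infinitePi_map fun j => hX (i, j)).mp
      (h.precomp (Prod.mk_right_injective i))
  have hprob : ∀ i j, IsProbabilityMeasure (μ.map (X (i, j))) := fun i j =>
    Measure.isProbabilityMeasure_map (hX (i, j)).aemeasurable
  rw [iIndepFun_iff_map_fun_eq_infinitePi_map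
    fun i => measurable_pi_iff.mpr fun j => hX (i, j)]
  simp only [hrow]
  rw [← Measure.infinitePi_map_curry fun i j => μ.map (X (i, j)),
    ← (iIndepFun_iff_map_fun_eq_infinitePi_map hX).mp h,
    Measure.map_map (MeasurableEquiv.measurable _) (measurable_pi_iff.mpr hX)]
  rfl

variable {P : ℕ} {X : (Fin P × ι) ⊕ (Fin P × ι) → Ω → ℂ} {K : ℝ≥0} {σ : ℝ} [Fintype ι]

/-- The `p`-th rank-one projection `α_p^* J β_p`, where the components of `α` and of `β` are the two
halves of the family `X`. -/
def rankOneProjection (X : (Fin P × ι) ⊕ (Fin P × ι) → Ω → ℂ) (J : ι → ι → ℂ) (p : Fin P)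
    (ω : Ω) : ℂ :=
  bilinearForm J (fun i => conj (X (Sum.inl (p, i)) ω)) (fun i => X (Sum.inr (p, i)) ω)

namespace IsSubGaussianFamily

omit [Fintype ι] in
/-- The vectors `α_p` (flag `true`) and `β_p` (flag `false`) are independent. -/
theorem iIndepFun_vectors (h : IsSubGaussianFamily X K σ μ) :
    iIndepFun (fun (q : Fin P × Bool) ω (i : ι) =>
      X (if q.2 then Sum.inl (q.1, i) else Sum.inr (q.1, i)) ω) μ := by
  refine iIndepFun_curry (X := fun (r : (Fin P × Bool) × ι) =>
    X (if r.1.2 then Sum.inl (r.1.1, r.2) else Sum.inr (r.1.1, r.2)))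
    (fun r => h.measurable _) (h.indep.precomp ?_)
  rintro ⟨⟨p, s⟩, i⟩ ⟨⟨p', s'⟩, i'⟩ heq
  cases s <;> cases s' <;> simp_all

omit [IsProbabilityMeasure μ] in
theorem measurable_rankOneProjection (h : IsSubGaussianFamily X K σ μ) (J : ι → ι → ℂ)
    (p : Fin P) : Measurable (rankOneProjection X J p) := by
  have h1 : Measurable fun ω i => (starRingEnd ℂ) (X (Sum.inl (p, i)) ω) :=
    measurable_pi_iff.mpr fun i =>
      Complex.continuous_conj.measurable.comp (h.measurable (Sum.inl (p, i)))
  have h2 : Measurable fun ω i => X (Sum.inr (p, i)) ω :=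
    measurable_pi_iff.mpr fun i => h.measurable (Sum.inr (p, i))
  have h3 := (measurable_bilinearForm J).comp (h1.prodMk h2)
  simp only [Function.comp_def] at h3
  exact h3

theorem iIndepFun_norm_rankOneProjection (h : IsSubGaussianFamily X K σ μ) (J : ι → ι → ℂ) :
    iIndepFun (fun p ω => ‖rankOneProjection X J p ω‖) μ := by
  have h1 := iIndepFun_curry (fun q => measurable_pi_iff.mpr fun i => h.measurable _)
    h.iIndepFun_vectors
  refine h1.comp (fun _ w => ‖bilinearForm J (fun i => (starRingEnd ℂ) (w true i)) (w false)‖)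
    fun _ => ?_
  refine ((measurable_bilinearForm J).comp (Measurable.prodMk ?_ ?_)).norm
  · exact measurable_pi_iff.mpr fun i => Complex.continuous_conj.measurable.comp
      ((measurable_pi_apply i).comp (measurable_pi_apply true))
  · exact measurable_pi_apply false

omit [Fintype ι] in
theorem indepFun_vectors (h : IsSubGaussianFamily X K σ μ) (p : Fin P) :
    IndepFun (fun ω i => (starRingEnd ℂ) (X (Sum.inl (p, i)) ω))
      (fun ω i => X (Sum.inr (p, i)) ω) μ := by
  have h1 := h.iIndepFun_vectors.indepFun (i := (p, true)) (j := (p, false)) (by simp)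
  exact h1.comp (φ := fun w i => (starRingEnd ℂ) (w i)) (ψ := id)
    (measurable_pi_iff.mpr fun i =>
      Complex.continuous_conj.measurable.comp (measurable_pi_apply i)) measurable_id

end IsSubGaussianFamily

end

/-- The average of `P` rank-one projections of a matrix lies, up to constants, between two multiples
of its Frobenius norm, with a failure probability exponentially small in `P`. -/
theorem exists_tail_bounds {K : ℝ≥0} {σ : ℝ} (hK : 0 < K) (hσ : 0 < σ) :
    ∃ l u γ : ℝ, 0 < l ∧ l ≤ u ∧ 0 < γ ∧
      ∀ {Ω : Type*} [MeasurableSpace Ω] {μ : Measure Ω} [IsProbabilityMeasure μ] {ι : Type}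
        [Fintype ι] {P : ℕ} {X : (Fin P × ι) ⊕ (Fin P × ι) → Ω → ℂ},
        IsSubGaussianFamily X K σ μ → ∀ (J : ι → ι → ℂ) (F : ℝ), 0 < F →
          ∑ i, ∑ j, ‖J i j‖ ^ 2 = F ^ 2 →
          μ.real {ω | ∑ p, ‖rankOneProjection X J p ω‖ ≤ P * (l * F) ∨
            P * (u * F) ≤ ∑ p, ‖rankOneProjection X J p ω‖} ≤ 2 * Real.exp (-γ * P) := by
  have hK' : (0 : ℝ) < K := hK
  set t : ℝ := 1 / (8 * K ^ 2) with ht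
  have ht0 : 0 < t := by positivity
  set v : ℝ := σ ^ 4 with hv
  have hv0 : 0 < v := by positivity
  set η : ℝ := v ^ 2 * t ^ 3 / 96 with hη
  have hη0 : 0 < η := by positivity
  have hlog : 0 < Real.log 4 := Real.log_pos (by norm_num)
  set γ : ℝ := η ^ 2 / (4 * v) with hγ
  have hγ0 : 0 < γ := by positivity
  refine ⟨η / 4, η / 4 + (γ + Real.log 4) / t, γ, by positivity,
    le_add_of_nonneg_right (by positivity), hγ0, ?_⟩
  intro Ω _ μ _ ι _ P X hX J F hF hJ
  -- Homogeneity reduces the claim to a matrix of Frobenius norm one.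
  set J₁ : ι → ι → ℂ := fun i j => ((F⁻¹ : ℝ) : ℂ) * J i j with hJ₁
  have hJ₁1 : ∑ i, ∑ j, ‖J₁ i j‖ ^ 2 = 1 := by
    simp only [hJ₁, norm_mul, mul_pow, ← Finset.mul_sum, hJ, Complex.norm_real,
      Real.norm_of_nonneg (inv_nonneg.mpr hF.le)]
    rw [← mul_pow, inv_mul_cancel₀ hF.ne', one_pow]
  have hZ : ∀ p ω, ‖rankOneProjection X J p ω‖ = F * ‖rankOneProjection X J₁ p ω‖ := by
    intro p ω
    rw [rankOneProjection, rankOneProjection, bilinearForm_smul, norm_mul, Complex.norm_real,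
      Real.norm_of_nonneg (inv_nonneg.mpr hF.le), ← mul_assoc, mul_inv_cancel₀ hF.ne', one_mul]
  have hU : ∀ p : Fin P, IsSubGaussianFamily
      (fun i ω => (starRingEnd ℂ) (X (Sum.inl (p, i)) ω)) K σ μ := fun p =>
    hX.star.precomp (g := fun i : ι => (Sum.inl (p, i) : (Fin P × ι) ⊕ (Fin P × ι)))
      fun i j hij => by simpa using hij
  have hV : ∀ p : Fin P, IsSubGaussianFamily (fun i => X (Sum.inr (p, i))) K σ μ := fun p =>
    hX.precomp (g := fun i : ι => (Sum.inr (p, i) : (Fin P × ι) ⊕ (Fin P × ι)))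
      fun i j hij => by simpa using hij
  have hmeas : ∀ p, Measurable fun ω => ‖rankOneProjection X J₁ p ω‖ := fun p =>
    (hX.measurable_rankOneProjection J₁ p).norm
  have hexp : ∀ p, ∫⁻ ω, ENNReal.ofReal (Real.exp (t * ‖rankOneProjection X J₁ p ω‖)) ∂μ ≤ 4 := by
    intro p
    refine (hU p).lintegral_exp_norm_bilinearForm_le (hV p) hK (hX.indepFun_vectors p) J₁ ht0.le ?_
    -- `16 K⁴ t² = 1 / 4`, within the limit `3 / 8`.
    rw [hJ₁1, ht]
    field_simp
    norm_num
  have hsq : ∀ p, ∫⁻ ω, ENNReal.ofReal (‖rankOneProjection X J₁ p ω‖ ^ 2) ∂μ =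
      ENNReal.ofReal v := by
    intro p
    refine ((hU p).lintegral_norm_sq_bilinearForm (hV p) hK (hX.indepFun_vectors p) J₁).trans ?_
    rw [hJ₁1, mul_one]
  have hind := hX.iIndepFun_norm_rankOneProjection J₁
  have hlow : μ.real {ω | ∑ p, ‖rankOneProjection X J p ω‖ ≤ P * (η / 4 * F)} ≤
      Real.exp (-γ * P) := by
    have h1 := measure_sum_le_le_exp (ε := η / 4) (s := v * t ^ 3 / 96) hmeas
      (fun _ _ => norm_nonneg _) hind (by positivity)
      fun p => integral_exp_neg_mul_le (hmeas p) (fun _ => norm_nonneg _) ht0 hv0 (hexp p) (hsq p)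
    have h2 : (v ^ 2 * t ^ 3 / 96) ^ 2 / (2 * v) - v * t ^ 3 / 96 * (η / 4) = γ := by
      rw [hγ, hη]
      field_simp
      ring
    rw [h2] at h1
    convert! h1 using 3
    ext ω
    simp only [hZ, ← Finset.mul_sum]
    rw [show (P : ℝ) * (η / 4 * F) = F * (P * (η / 4)) by ring, mul_le_mul_iff_right₀ hF]
  have hupp : μ.real {ω | P * ((η / 4 + (γ + Real.log 4) / t) * F) ≤
      ∑ p, ‖rankOneProjection X J p ω‖} ≤ Real.exp (-γ * P) := by
    have h1 := measure_le_sum_le_exp (ε := η / 4 + (γ + Real.log 4) / t) (r := Real.log 4) hmeas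
      hind ht0.le fun p => (hexp p).trans (by rw [Real.exp_log (by norm_num)]; simp)
    have h2 : γ ≤ t * (η / 4 + (γ + Real.log 4) / t) - Real.log 4 := by
      rw [mul_add, mul_div_cancel₀ _ ht0.ne']
      have : 0 ≤ t * (η / 4) := by positivity
      linarith
    refine le_trans (le_of_eq ?_) (h1.trans (Real.exp_le_exp.mpr (by gcongr)))
    congr 1
    ext ω
    simp only [Set.mem_ofPred_eq, hZ, ← Finset.mul_sum]
    rw [show (P : ℝ) * ((η / 4 + (γ + Real.log 4) / t) * F) =
      F * (P * (η / 4 + (γ + Real.log 4) / t)) by ring, mul_le_mul_iff_right₀ hF]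
  calc _ ≤ _ := measureReal_union_le _ _
    _ ≤ Real.exp (-γ * P) + Real.exp (-γ * P) := add_le_add hlow hupp
    _ = _ := by ring

/-! ### Nets of the unit sphere -/

section

variable {E : Type*} [NormedAddCommGroup E] [NormedSpace ℝ E] [FiniteDimensional ℝ E]

open Module Metric in
/-- An `ε`-separated subset of the unit ball has at most `(3 / ε) ^ dim` points: the balls of radius
`ε / 2` around them are disjoint and contained in the ball of radius `3 / 2`. -/
theorem card_le_of_separated {ε : ℝ} (hε : 0 < ε) (hε1 : ε ≤ 1) (s : Finset E)
    (hs : ∀ c ∈ s, ‖c‖ ≤ 1) (h : ∀ c ∈ s, ∀ d ∈ s, c ≠ d → ε ≤ ‖c - d‖) :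
    (s.card : ℝ) ≤ (3 / ε) ^ finrank ℝ E := by
  borelize E
  let μ : Measure E := Measure.addHaar
  have hδ : 0 < ε / 2 := by positivity
  have hρ : (0 : ℝ) < 3 / 2 := by norm_num
  set A := ⋃ c ∈ s, ball (c : E) (ε / 2) with hA
  have D : Set.PairwiseDisjoint (s : Set E) fun c => ball (c : E) (ε / 2) := by
    intro c hc d hd hcd
    refine ball_disjoint_ball ?_
    rw [dist_eq_norm, add_halves]
    exact h c hc d hd hcd
  have A_subset : A ⊆ ball (0 : E) (3 / 2) := by
    refine Set.iUnion₂_subset fun x hx => ball_subset_ball' ?_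
    rw [dist_zero_right]
    linarith [hs x hx]
  have I : (s.card : ℝ≥0∞) * ENNReal.ofReal ((ε / 2) ^ finrank ℝ E) * μ (ball 0 1) ≤
      ENNReal.ofReal ((3 / 2) ^ finrank ℝ E) * μ (ball 0 1) :=
    calc
      (s.card : ℝ≥0∞) * ENNReal.ofReal ((ε / 2) ^ finrank ℝ E) * μ (ball 0 1) = μ A := by
        rw [hA, measure_biUnion_finset D fun c _ => measurableSet_ball]
        simp only [μ.addHaar_ball_of_pos _ hδ]
        simp only [Finset.sum_const, nsmul_eq_mul, mul_assoc]
      _ ≤ μ (ball (0 : E) (3 / 2)) := measure_mono A_subset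
      _ = ENNReal.ofReal ((3 / 2) ^ finrank ℝ E) * μ (ball 0 1) := by
        simp only [μ.addHaar_ball_of_pos _ hρ]
  have J : (s.card : ℝ≥0∞) * ENNReal.ofReal ((ε / 2) ^ finrank ℝ E) ≤
      ENNReal.ofReal ((3 / 2) ^ finrank ℝ E) :=
    (ENNReal.mul_le_mul_iff_left (measure_ball_pos _ _ zero_lt_one).ne' measure_ball_lt_top.ne).1 I
  have h1 : (s.card : ℝ) * (ε / 2) ^ finrank ℝ E ≤ (3 / 2) ^ finrank ℝ E := by
    have := ENNReal.toReal_le_of_le_ofReal (by positivity) J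
    rwa [ENNReal.toReal_mul, ENNReal.toReal_natCast, ENNReal.toReal_ofReal (by positivity)] at this
  rw [← le_div_iff₀ (by positivity), ← div_pow] at h1
  refine h1.trans_eq ?_
  congr 1
  field_simp

open Module in
/-- A maximal `ε`-separated subset of the unit sphere is an `ε`-net. -/
theorem exists_net_unitSphere (E : Type*) [NormedAddCommGroup E] [NormedSpace ℝ E]
    [FiniteDimensional ℝ E] {ε : ℝ} (hε : 0 < ε) (hε1 : ε ≤ 1) :
    ∃ s : Finset E, (∀ x ∈ s, ‖x‖ = 1) ∧ (s.card : ℝ) ≤ (3 / ε) ^ finrank ℝ E ∧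
      ∀ x : E, ‖x‖ = 1 → ∃ y ∈ s, ‖x - y‖ ≤ ε := by
  classical
  let T : Set ℕ := {n | ∃ s : Finset E, s.card = n ∧ (∀ x ∈ s, ‖x‖ = 1) ∧
    ∀ c ∈ s, ∀ d ∈ s, c ≠ d → ε ≤ ‖c - d‖}
  have hT0 : T.Nonempty := ⟨0, ∅, by simp⟩
  have hTb : BddAbove T := by
    refine ⟨⌊(3 / ε) ^ finrank ℝ E⌋₊, ?_⟩
    rintro n ⟨s, rfl, hs, hsep⟩
    exact Nat.le_floor (card_le_of_separated hε hε1 s (fun c hc => (hs c hc).le) hsep)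
  obtain ⟨s, hcard, hs, hsep⟩ := Nat.sSup_mem hT0 hTb
  refine ⟨s, hs, card_le_of_separated hε hε1 s (fun c hc => (hs c hc).le) hsep, fun x hx => ?_⟩
  by_contra! hcon
  have hxs : x ∉ s := fun hxs => by
    have := hcon x hxs
    simp only [sub_self, norm_zero] at this
    linarith
  have hmem : (insert x s).card ∈ T := by
    refine ⟨insert x s, rfl, ?_, ?_⟩
    · intro y hy
      rcases Finset.mem_insert.mp hy with rfl | hy
      exacts [hx, hs y hy]
    · intro c hc d hd hcd
      rcases Finset.mem_insert.mp hc with hcx | hcs <;>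
        rcases Finset.mem_insert.mp hd with hdx | hds
      · exact absurd (hcx.trans hdx.symm) hcd
      · rw [hcx]
        exact (hcon d hds).le
      · rw [hdx, norm_sub_rev]
        exact (hcon c hcs).le
      · exact hsep c hcs d hds hcd
  have := le_csSup hTb hmem
  rw [Finset.card_insert_of_notMem hxs, hcard] at this
  omega

/-- Two-sided bounds of a seminorm on an `ε`-net of the unit sphere extend to the whole space. -/
theorem bounds_of_bounds_on_net {ρ : Seminorm ℝ E} {ε : ℝ} (hε : ε ≤ 1 / 2)
    {s : Finset E} (hs : ∀ x : E, ‖x‖ = 1 → ∃ y ∈ s, ‖x - y‖ ≤ ε) {l u : ℝ}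
    (hl : ∀ y ∈ s, l ≤ ρ y) (hu : ∀ y ∈ s, ρ y ≤ u) (v : E) :
    (l - 2 * u * ε) * ‖v‖ ≤ ρ v ∧ ρ v ≤ 2 * u * ‖v‖ := by
  rcases eq_or_ne v 0 with rfl | hv
  · simp
  have hv' : 0 < ‖v‖ := norm_pos_iff.mpr hv
  have hunit : ∀ w : E, w ≠ 0 → ‖(‖w‖⁻¹ • w)‖ = 1 := fun w hw => by
    rw [norm_smul, norm_inv, norm_norm, inv_mul_cancel₀ (norm_pos_iff.mpr hw).ne']
  have hscale : ∀ w : E, w ≠ 0 → ρ w = ‖w‖ * ρ (‖w‖⁻¹ • w) := fun w hw => by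
    rw [map_smul_eq_mul, norm_inv, norm_norm, ← mul_assoc,
      mul_inv_cancel₀ (norm_pos_iff.mpr hw).ne', one_mul]
  have hcont : Continuous ρ := ρ.convexOn.locallyLipschitz.continuous
  obtain ⟨x₀, hx₀, hmax⟩ := (isCompact_sphere (0 : E) 1).exists_isMaxOn
    ⟨‖v‖⁻¹ • v, by simpa using hunit v hv⟩ hcont.continuousOn
  have hx₀' : ‖x₀‖ = 1 := by simpa using hx₀
  have hmax' : ∀ w : E, ρ w ≤ ρ x₀ * ‖w‖ := by
    intro w
    rcases eq_or_ne w 0 with rfl | hw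
    · simp
    rw [hscale w hw, mul_comm]
    gcongr
    exact hmax (by simpa using hunit w hw)
  have h0 : 0 ≤ ρ x₀ := apply_nonneg ρ x₀
  have hx₀u : ρ x₀ ≤ 2 * u := by
    obtain ⟨y, hy, hxy⟩ := hs x₀ hx₀'
    have h1 : ρ x₀ ≤ ρ y + ρ (x₀ - y) := by
      have := map_add_le_add ρ y (x₀ - y)
      rwa [add_sub_cancel] at this
    have h2 := hmax' (x₀ - y)
    have h3 := hu y hy
    nlinarith
  refine ⟨?_, (hmax' v).trans (by gcongr)⟩
  obtain ⟨y, hy, hxy⟩ := hs _ (hunit v hv)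
  have h1 : ρ y ≤ ρ (‖v‖⁻¹ • v) + ρ (‖v‖⁻¹ • v - y) := by
    have := map_sub_le_add ρ (‖v‖⁻¹ • v) (‖v‖⁻¹ • v - y)
    rwa [sub_sub_cancel] at this
  have h2 := hmax' (‖v‖⁻¹ • v - y)
  have h3 := hl y hy
  have h4 : ρ x₀ * ‖‖v‖⁻¹ • v - y‖ ≤ 2 * u * ε := by
    gcongr
    exact h0.trans hx₀u
  rw [hscale v hv, mul_comm]
  gcongr
  linarith

end

/-! ### Sparse images -/

/-- The images supported on a given set of pixels. -/
def imagesSupportedOn {N₁ : ℕ} (T : Finset (Pixel N₁)) :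
    Submodule ℝ (EuclideanSpace ℝ (Pixel N₁)) where
  carrier := {v | ∀ n ∉ T, v n = 0}
  add_mem' hv hw n hn := by simp [hv n hn, hw n hn]
  zero_mem' n _ := by simp
  smul_mem' a v hv n hn := by simp [hv n hn]

theorem finrank_imagesSupportedOn_le {N₁ : ℕ} (T : Finset (Pixel N₁)) :
    Module.finrank ℝ (imagesSupportedOn T) ≤ T.card := by
  let f : imagesSupportedOn T →ₗ[ℝ] (T → ℝ) :=
    { toFun := fun v n => v.1 n
      map_add' := fun v w => by ext n; simp
      map_smul' := fun a v => by ext n; simp }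
  have hf : Function.Injective f := by
    intro v w hvw
    ext n
    by_cases hn : n ∈ T
    · exact congrFun hvw ⟨n, hn⟩
    · rw [v.2 n hn, w.2 n hn]
  simpa using LinearMap.finrank_le_finrank_of_injective hf

theorem mem_sparseImages_of_mem_imagesSupportedOn {N₁ K : ℕ} {T : Finset (Pixel N₁)}
    (hT : T.card ≤ K) {v : EuclideanSpace ℝ (Pixel N₁)} (hv : v ∈ imagesSupportedOn T) :
    v ∈ sparseImages N₁ K := by
  refine le_trans ?_ hT
  rw [← Set.ncard_coe_finset]
  refine Set.ncard_le_ncard (fun n hn => ?_) T.finite_toSet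
  by_contra hnT
  exact hn (hv n hnT)

theorem exists_mem_imagesSupportedOn {N₁ K : ℕ} (hK : K ≤ N₁ ^ 2)
    {v : EuclideanSpace ℝ (Pixel N₁)} (hv : v ∈ sparseImages N₁ K) :
    ∃ T : Finset (Pixel N₁), T.card = K ∧ v ∈ imagesSupportedOn T := by
  classical
  have h1 : (Finset.univ.filter fun n => v n ≠ 0).card ≤ K := by
    rw [← Set.ncard_coe_finset]
    simpa [sparseImages] using hv
  obtain ⟨T, hT, -, hcard⟩ := Finset.exists_subsuperset_card_eq
    (Finset.subset_univ (Finset.univ.filter fun n => v n ≠ 0)) h1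
    (by simpa [Pixel, sq] using hK)
  refine ⟨T, hcard, fun n hn => ?_⟩
  by_contra hne
  exact hn (hT (by simpa using hne))

/-- The number of supports of size `K` times the bound `(3 / ε) ^ K` of the cardinality of a net for
each of them. -/
theorem choose_mul_pow_le_exp {N K : ℕ} (hK : 0 < K) (hKN : K ≤ N) {ε : ℝ} (hε : 0 < ε) :
    (N.choose K : ℝ) * (3 / ε) ^ K ≤
      Real.exp (K * (Real.log (Real.exp 1 * N / K) + Real.log (3 / ε))) := by
  have hK' : (0 : ℝ) < K := by exact_mod_cast hK
  have hN' : (0 : ℝ) < N := by exact_mod_cast hK.trans_le hKN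
  have h1 : (N.choose K : ℝ) ≤ (Real.exp 1 * N / K) ^ K := by
    refine (Nat.choose_le_pow_div K N).trans ?_
    have h2 := Real.pow_div_factorial_le_exp (K : ℝ) hK'.le K
    have h3 : (0 : ℝ) < K.factorial := by exact_mod_cast K.factorial_pos
    rw [div_le_iff₀ h3] at h2 ⊢
    rw [div_pow, mul_pow, ← Real.exp_nat_mul, mul_one, div_mul_eq_mul_div,
      le_div_iff₀ (by positivity)]
    nlinarith [pow_pos hN' K]
  rw [Real.exp_nat_mul, Real.exp_add, Real.exp_log (by positivity), Real.exp_log (by positivity),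
    mul_pow]
  gcongr

/-! ### The sensing operator -/

section

variable {Q B N₁ P : ℕ}

/-- The block-diagonal matrix with the `B` given `Q × Q` blocks. -/
def blockMatrix (y : Fin B × Fin Q × Fin Q → ℂ) (i j : Fin B × Fin Q) : ℂ :=
  if i.1 = j.1 then y (i.1, i.2, j.2) else 0

theorem sum_norm_sq_blockMatrix (y : Fin B × Fin Q × Fin Q → ℂ) :
    ∑ i, ∑ j, ‖blockMatrix y i j‖ ^ 2 = ∑ r, ‖y r‖ ^ 2 := by
  simp only [Fintype.sum_prod_type, blockMatrix]
  refine Finset.sum_congr rfl fun b _ => Finset.sum_congr rfl fun j _ => ?_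
  rw [Finset.sum_eq_single b (fun b' _ hb' => by simp [hb'.symm]) (by simp)]
  simp

theorem ropMatrix_mulVec (α β : Fin P → Fin B → Fin Q → ℂ) (y : Fin B × Fin Q × Fin Q → ℂ)
    (p : Fin P) :
    (ropMatrix α β).mulVec y p =
      bilinearForm (blockMatrix y) (fun i => conj (α p i.1 i.2)) (fun j => β p j.1 j.2) := by
  simp only [Matrix.mulVec, dotProduct, bilinearForm, Fintype.sum_prod_type, ropMatrix,
    Matrix.of_apply, blockMatrix]
  refine Finset.sum_congr rfl fun b _ => Finset.sum_congr rfl fun j _ => ?_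
  rw [Finset.sum_eq_single b (fun b' _ hb' => by simp [hb'.symm]) (by simp), Finset.sum_mul]
  refine Finset.sum_congr rfl fun k _ => ?_
  simp only [if_true]
  ring

theorem toComplex_add (v w : EuclideanSpace ℝ (Pixel N₁)) :
    toComplex (v + w) = toComplex v + toComplex w := by
  ext n
  simp [toComplex]

theorem toComplex_smul (a : ℝ) (v : EuclideanSpace ℝ (Pixel N₁)) :
    toComplex (a • v) = (a : ℂ) • toComplex v := by
  ext n
  simp [toComplex]

/-- The seminorm `v ↦ ‖A v‖₁ / P` on real images. -/
noncomputable def meanAbs (A : Matrix (Fin P) (Pixel N₁) ℂ) :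
    Seminorm ℝ (EuclideanSpace ℝ (Pixel N₁)) :=
  Seminorm.of (fun v => 1 / (P : ℝ) * ∑ p, ‖A.mulVec (toComplex v) p‖)
    (fun v w => by
      rw [← mul_add, ← Finset.sum_add_distrib, toComplex_add, Matrix.mulVec_add]
      gcongr
      exact norm_add_le _ _)
    fun a v => by
      simp only [toComplex_smul, Matrix.mulVec_smul, Pi.smul_apply, norm_smul, Complex.norm_real,
        ← Finset.mul_sum]
      ring

theorem meanAbs_apply (A : Matrix (Fin P) (Pixel N₁) ℂ) (v : EuclideanSpace ℝ (Pixel N₁)) :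
    meanAbs A v = 1 / (P : ℝ) * ∑ p, ‖A.mulVec (toComplex v) p‖ := rfl

/-- The `RIP_{ℓ₂/ℓ₁}` follows from two-sided bounds on nets of the unit spheres of the spaces of
images supported on `K` pixels. -/
theorem ripL2L1_of_bounds_on_nets {A : Matrix (Fin P) (Pixel N₁) ℂ} {K : ℕ} (hK : K ≤ N₁ ^ 2)
    {ε l u m M : ℝ} (hε : ε ≤ 1 / 2) (hm : 0 < m) (hmM : m < M) (hl : m ≤ l - 2 * u * ε)
    (hu : 2 * u ≤ M) (net : ∀ T : Finset (Pixel N₁), Finset (imagesSupportedOn T))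
    (hnet : ∀ T, ∀ x : imagesSupportedOn T, ‖x‖ = 1 → ∃ y ∈ net T, ‖x - y‖ ≤ ε)
    (h : ∀ T : Finset (Pixel N₁), T.card = K → ∀ y ∈ net T,
      l ≤ meanAbs A y ∧ meanAbs A y ≤ u) : RIPL2L1 A K m M := by
  refine ⟨hm, hmM, fun v hv => ?_⟩
  obtain ⟨T, hT, hvT⟩ := exists_mem_imagesSupportedOn hK hv
  have h1 := bounds_of_bounds_on_net (ρ := (meanAbs A).comp (imagesSupportedOn T).subtype) hε
    (hnet T) (fun y hy => (h T hT y hy).1) (fun y hy => (h T hT y hy).2) ⟨v, hvT⟩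
  rw [← meanAbs_apply]
  refine ⟨le_trans ?_ h1.1, h1.2.trans ?_⟩
  · exact mul_le_mul_of_nonneg_right hl (norm_nonneg _)
  · exact mul_le_mul_of_nonneg_right hu (norm_nonneg _)

/-- The measurements are rank-one projections of one block-diagonal matrix, which does not depend on
the sketches. -/
theorem irop_mulVec (S : Interferometer Q B N₁) {Ω : Type*}
    (α β : Ω → Fin P → Fin B → Fin Q → ℂ) (ω : Ω) (x : Pixel N₁ → ℂ) (p : Fin P) :
    (irop S (α ω) (β ω)).mulVec x p = rankOneProjection (sketchComponents α β)
      (blockMatrix ((S.interp₀ * dft2 N₁).mulVec x)) p ω := by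
  rw [irop, Matrix.mul_assoc, ← Matrix.mulVec_mulVec, ropMatrix_mulVec]
  rfl

/-- The infimum that defines the sub-Gaussian norm need not be attained at `κ` (and `κ` may vanish),
so the scale is enlarged to `κ + 1`. -/
theorem SubGaussianSketches.isSubGaussianFamily {Ω : Type*} [MeasurableSpace Ω] {μ : Measure Ω}
    {α β : Ω → Fin P → Fin B → Fin Q → ℂ} {κ σ : ℝ≥0} (h : SubGaussianSketches μ α β κ σ) :
    IsSubGaussianFamily (sketchComponents α β) (κ + 1) σ μ where
  measurable := h.measurable
  indep := h.indep
  mean_zero := h.mean_zero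
  variance_eq := h.variance_eq
  lintegral_exp_le i := by
    have h1 : subGaussianNorm (sketchComponents α β i) μ < ((κ + 1 : ℝ≥0) : ℝ≥0∞) :=
      (h.subGaussian i).trans_lt (by exact_mod_cast lt_add_one κ)
    simp only [subGaussianNorm, iInf_lt_iff] at h1
    obtain ⟨t, ht, hexp, htκ⟩ := h1
    have h2 : t ≤ ((κ + 1 : ℝ≥0) : ℝ) := by
      rw [← ENNReal.ofReal_coe_nnreal] at htκ
      exact (ENNReal.ofReal_lt_ofReal_iff'.mp htκ).1.le
    refine (lintegral_mono fun ω => ?_).trans hexp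
    gcongr

end

/-! ### The bounds for the sensing operator -/

section

variable {Q B N₁ P : ℕ}

theorem Interferometer.varpi_pos (S : Interferometer Q B N₁) (hN : 0 < N₁) : 0 < S.varpi := by
  have := S.L_pos
  have : (0 : ℝ) < N₁ := by exact_mod_cast hN
  unfold Interferometer.varpi
  positivity

/-- The restricted isometry property rules out the empty set of visibilities: the lower bound fails
for an image with a single nonzero pixel if the normalization `1 / V` is `1 / 0 = 0`. -/
theorem Interferometer.VisibilityRIP.numVis_pos {S : Interferometer Q B N₁} {K : ℕ}
    (h : S.VisibilityRIP K (1 / 2)) (hN : 0 < N₁) (hK : 0 < K) : 0 < S.numVis := by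
  by_contra hV
  replace hV : S.numVis = 0 := by omega
  let n : Pixel N₁ := (⟨0, hN⟩, ⟨0, hN⟩)
  have hmem : EuclideanSpace.single n (1 : ℝ) ∈ imagesSupportedOn {n} := by
    intro m hm
    simp only [Finset.mem_singleton] at hm
    simp [hm]
  have h1 := (h _ (mem_sparseImages_of_mem_imagesSupportedOn
    (by rwa [Finset.card_singleton]) hmem)).1
  rw [hV] at h1
  norm_num at h1

/-- The restricted isometry property, as bounds of the Frobenius norm of the interferometric
matrices of a unit-norm sparse image. -/
theorem Interferometer.VisibilityRIP.frobenius_bounds {S : Interferometer Q B N₁} {K : ℕ}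
    (h : S.VisibilityRIP K (1 / 2)) (hN : 0 < N₁) (hK : 0 < K)
    {v : EuclideanSpace ℝ (Pixel N₁)} (hv : v ∈ sparseImages N₁ K) (hv1 : ‖v‖ = 1) :
    S.varpi * √(S.numVis / (2 * (N₁ : ℝ) ^ 2)) ≤
        √(∑ r, ‖((S.interp₀ * dft2 N₁).mulVec (toComplex v)) r‖ ^ 2) ∧
      √(∑ r, ‖((S.interp₀ * dft2 N₁).mulVec (toComplex v)) r‖ ^ 2) ≤
        S.varpi * √(3 * S.numVis / (2 * (N₁ : ℝ) ^ 2)) := by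
  have hϖ := S.varpi_pos hN
  have hV : (0 : ℝ) < S.numVis := by exact_mod_cast h.numVis_pos hN hK
  have hN' : (0 : ℝ) < N₁ := by exact_mod_cast hN
  obtain ⟨h1, h2⟩ := h v hv
  rw [hv1, div_mul_eq_mul_div] at h1 h2
  rw [le_div_iff₀ (by positivity)] at h1
  rw [div_le_iff₀ (by positivity)] at h2
  constructor
  · refine Real.le_sqrt_of_sq_le ?_
    rw [mul_pow, Real.sq_sqrt (by positivity), mul_div_assoc', div_le_iff₀ (by positivity)]
    nlinarith
  · refine Real.sqrt_le_iff.mpr ⟨by positivity, ?_⟩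
    rw [mul_pow, Real.sq_sqrt (by positivity), mul_div_assoc', le_div_iff₀ (by positivity)]
    nlinarith

/-- With `P ≥ C K log (12 e N / K)`, the exponentially small failure probability of one vector
absorbs the cardinality of the nets of all the supports. -/
theorem net_card_mul_exp_lt {N K : ℕ} (hK : 0 < K) (hKN : K ≤ N) {ε γ : ℝ} (hε : 0 < ε)
    (hε1 : ε ≤ 1) (hγ : 0 < γ)
    (hP : 2 * (Real.log (3 / ε) + 1) / γ * K * Real.log (12 * Real.exp 1 * N / K) ≤ P) :
    (N.choose K : ℝ) * (3 / ε) ^ K * (2 * Real.exp (-γ * P)) < Real.exp (-(γ / 2 * P)) := by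
  have hK' : (1 : ℝ) ≤ K := by exact_mod_cast hK
  have hK0 : (0 : ℝ) < K := by linarith
  have hN' : (0 : ℝ) < N := by exact_mod_cast hK.trans_le hKN
  have hD : 0 ≤ Real.log (3 / ε) := Real.log_nonneg (by rw [le_div_iff₀ hε]; linarith)
  set D := Real.log (3 / ε)
  have hΛ1 : Real.log (12 * Real.exp 1 * N / K) =
      Real.log 12 + Real.log (Real.exp 1 * N / K) := by
    rw [← Real.log_mul (by norm_num) (by positivity)]
    congr 1
    ring
  have hΛ2 : 1 ≤ Real.log (Real.exp 1 * N / K) := by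
    rw [Real.le_log_iff_exp_le (by positivity), le_div_iff₀ hK0]
    gcongr
  rw [hΛ1] at hP
  set Λ := Real.log (Real.exp 1 * N / K) with hΛ
  have h12 : Real.log 2 < Real.log 12 := Real.log_lt_log (by norm_num) (by norm_num)
  have h2 : 0 < Real.log 2 := Real.log_pos (by norm_num)
  have hP' : (D + 1) * (K * (Real.log 12 + Λ)) ≤ γ / 2 * P := by
    have h3 : (D + 1) * (K * (Real.log 12 + Λ)) =
        γ / 2 * (2 * (D + 1) / γ * K * (Real.log 12 + Λ)) := by
      field_simp
    rw [h3]
    gcongr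
  calc (N.choose K : ℝ) * (3 / ε) ^ K * (2 * Real.exp (-γ * P))
      ≤ Real.exp (K * (Λ + D)) * (2 * Real.exp (-γ * P)) := by
        gcongr
        exact choose_mul_pow_le_exp hK hKN hε
    _ = Real.exp (Real.log 2 + K * (Λ + D) - γ * P) := by
        conv_lhs => rw [← Real.exp_log (show (0 : ℝ) < 2 by norm_num)]
        rw [← Real.exp_add, ← Real.exp_add]
        congr 1
        ring
    _ < Real.exp (-(γ / 2 * P)) := by
        refine Real.exp_lt_exp.mpr ?_
        have h4 : Real.log 12 ≤ K * Real.log 12 := le_mul_of_one_le_left (by linarith) hK'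
        have h5 : K * D ≤ D * (K * (Real.log 12 + Λ)) := by
          have : 0 ≤ D * K := by positivity
          nlinarith
        nlinarith

end

end RadioInterferometry

open RadioInterferometry in
theorem proposition2 (κ σ : ℝ≥0) (hσ : 0 < σ) :
    ∃ C c c₁ c₂ : ℝ, 0 < C ∧ 0 < c ∧ 0 < c₁ ∧ 0 < c₂ ∧
      ∀ (Q B N₁ P K₀ : ℕ) (S : Interferometer Q B N₁) (plog : MvPolynomial (Fin 3) ℝ)
        (Ω : Type*) [MeasurableSpace Ω] (μ : Measure Ω) [IsProbabilityMeasure μ]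
        (α β : Ω → Fin P → Fin B → Fin Q → ℂ),
        0 < K₀ → K₀ ≤ N₁ ^ 2 →
        S.DistinctVisibilities →
        S.VisibilityRIPAssumption plog K₀ (1 / 2) →
        SubGaussianSketches μ α β κ σ →
        C * K₀ * Real.log (12 * Real.exp 1 * (N₁ : ℝ) ^ 2 / K₀) ≤ P →
        4 * K₀ * plogValue plog (N₁ ^ 2) K₀ (1 / 2) ≤ S.numVis →
        ∃ m M : ℝ,
          2 / 3 * c₁ * S.varpi * Real.sqrt (S.numVis / (2 * (N₁ : ℝ) ^ 2)) < m ∧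
          M < 4 / 3 * c₂ * S.varpi * Real.sqrt (3 * S.numVis / (2 * (N₁ : ℝ) ^ 2)) ∧
          1 - Real.exp (-(c * P)) < μ.real {ω | RIPL2L1 (irop S (α ω) (β ω)) K₀ m M} := by
  have hK1 : 0 < κ + 1 := by positivity
  have hσ' : (0 : ℝ) < σ := hσ
  obtain ⟨l, u, γ, hl, hlu, hγ, htail⟩ := exists_tail_bounds hK1 hσ'
  have hu : 0 < u := hl.trans_le hlu
  -- The net is finer than the ratio of the two bounds, so that the lower bound survives.
  set ε : ℝ := l / (8 * u) with hε
  have hε0 : 0 < ε := by positivity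
  have hε8 : ε ≤ 1 / 8 := by
    rw [hε, div_le_iff₀ (by positivity)]
    linarith
  have hD : 0 ≤ Real.log (3 / ε) := Real.log_nonneg (by rw [le_div_iff₀ hε0]; linarith)
  refine ⟨2 * (Real.log (3 / ε) + 1) / γ, γ / 2, l / 2, 3 * u, by positivity, by positivity,
    by positivity, by positivity, ?_⟩
  intro Q B N₁ P K₀ S plog Ω _ μ _ α β hK₀ hKN _ hRIP hsk hP hV
  have hN : 0 < N₁ := by
    rcases Nat.eq_zero_or_pos N₁ with rfl | h
    · simp at hKN
      omega
    · exact h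
  have hN' : (0 : ℝ) < N₁ := by exact_mod_cast hN
  have hrip : S.VisibilityRIP K₀ (1 / 2) := hRIP (by norm_num; exact hV)
  have hVpos : (0 : ℝ) < S.numVis := by exact_mod_cast hrip.numVis_pos hN hK₀
  have hϖ := S.varpi_pos hN
  set a : ℝ := S.varpi * √(S.numVis / (2 * (N₁ : ℝ) ^ 2)) with ha
  set b : ℝ := S.varpi * √(3 * S.numVis / (2 * (N₁ : ℝ) ^ 2)) with hb
  have ha0 : 0 < a := by positivity
  have hab : a ≤ b := by
    rw [ha, hb]
    gcongr
    linarith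
  have hba : b ≤ 2 * a := by
    rw [ha, hb, mul_left_comm]
    gcongr
    rw [Real.sqrt_le_left (by positivity), mul_pow, Real.sq_sqrt (by positivity),
      mul_div_assoc']
    gcongr
    linarith
  have hP0 : (0 : ℝ) < P := by
    refine lt_of_lt_of_le ?_ hP
    have h1 : (0 : ℝ) < K₀ := by exact_mod_cast hK₀
    have h2 : (K₀ : ℝ) ≤ (N₁ : ℝ) ^ 2 := by exact_mod_cast hKN
    have h3 : 0 < Real.log (12 * Real.exp 1 * (N₁ : ℝ) ^ 2 / K₀) := by
      refine Real.log_pos ?_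
      rw [lt_div_iff₀ h1]
      nlinarith [Real.add_one_le_exp 1]
    positivity
  choose net hnet1 hnetcard hnet using fun T : Finset (Pixel N₁) =>
    exists_net_unitSphere (imagesSupportedOn T) hε0 (hε8.trans (by norm_num))
  let J : EuclideanSpace ℝ (Pixel N₁) → Fin B × Fin Q × Fin Q → ℂ :=
    fun v => (S.interp₀ * dft2 N₁).mulVec (toComplex v)
  let F : EuclideanSpace ℝ (Pixel N₁) → ℝ := fun v => √(∑ r, ‖J v r‖ ^ 2)
  let Z : EuclideanSpace ℝ (Pixel N₁) → Ω → ℝ := fun v ω =>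
    ∑ p, ‖rankOneProjection (sketchComponents α β) (blockMatrix (J v)) p ω‖
  let bad : EuclideanSpace ℝ (Pixel N₁) → Set Ω := fun v =>
    {ω | Z v ω ≤ P * (l * F v) ∨ P * (u * F v) ≤ Z v ω}
  have hF : ∀ T : Finset (Pixel N₁), T.card = K₀ → ∀ y ∈ net T, a ≤ F y ∧ F y ≤ b :=
    fun T hT y hy => hrip.frobenius_bounds hN hK₀
      (mem_sparseImages_of_mem_imagesSupportedOn hT.le y.2) (hnet1 T y hy)
  let 𝒯 : Finset (Finset (Pixel N₁)) := Finset.univ.powersetCard K₀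
  have hmem : ∀ T, T ∈ 𝒯 ↔ T.card = K₀ := fun T => by simp [𝒯, Finset.mem_powersetCard]
  have hbad : μ.real (⋃ T ∈ 𝒯, ⋃ y ∈ net T, bad y) < Real.exp (-(γ / 2 * P)) := by
    have hone : ∀ T ∈ 𝒯, μ.real (⋃ y ∈ net T, bad y) ≤
        (3 / ε) ^ K₀ * (2 * Real.exp (-γ * P)) := by
      intro T hT
      rw [hmem] at hT
      have h1 : ∀ y ∈ net T, μ.real (bad y) ≤ 2 * Real.exp (-γ * P) := fun y hy =>
        htail hsk.isSubGaussianFamily (blockMatrix (J y)) (F y)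
          (ha0.trans_le (hF T hT y hy).1) (by
            rw [sum_norm_sq_blockMatrix, Real.sq_sqrt (Finset.sum_nonneg fun _ _ => by positivity)])
      refine (measureReal_biUnion_finset_le _ _).trans ((Finset.sum_le_sum h1).trans ?_)
      rw [Finset.sum_const, nsmul_eq_mul]
      gcongr
      refine (hnetcard T).trans (pow_le_pow_right₀ ?_ ?_)
      · rw [le_div_iff₀ hε0]
        linarith
      · exact (finrank_imagesSupportedOn_le T).trans hT.le
    refine ((measureReal_biUnion_finset_le _ _).trans (Finset.sum_le_sum hone)).trans_lt ?_
    rw [Finset.sum_const, nsmul_eq_mul, ← mul_assoc]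
    have hcard : 𝒯.card = (N₁ ^ 2).choose K₀ := by
      simp [𝒯, Finset.card_powersetCard, Pixel, sq]
    rw [hcard]
    exact net_card_mul_exp_lt hK₀ hKN hε0 (hε8.trans (by norm_num)) hγ (by exact_mod_cast hP)
  refine ⟨l * a / 2, 2 * (u * b), ?_, ?_, ?_⟩
  · have h1 : 2 / 3 * (l / 2) * S.varpi * √(S.numVis / (2 * (N₁ : ℝ) ^ 2)) = l * a / 3 := by
      rw [ha]
      ring
    rw [h1]
    linarith [mul_pos hl ha0]
  · have h1 : 4 / 3 * (3 * u) * S.varpi * √(3 * S.numVis / (2 * (N₁ : ℝ) ^ 2)) =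
        4 * (u * b) := by
      rw [hb]
      ring
    rw [h1]
    linarith [mul_pos hu (ha0.trans_le hab)]
  -- The event of the theorem need not be measurable: only its complement is estimated, through the
  -- outer measure.
  have hsub : {ω | RIPL2L1 (irop S (α ω) (β ω)) K₀ (l * a / 2) (2 * (u * b))}ᶜ ⊆
      ⋃ T ∈ 𝒯, ⋃ y ∈ net T, bad y := by
    rw [Set.compl_subset_comm]
    intro ω hω
    simp only [Set.mem_compl_iff, Set.mem_iUnion, not_exists] at hω
    have hlab : l * a ≤ u * b := mul_le_mul hlu hab ha0.le hu.le
    have hla : 0 < l * a := mul_pos hl ha0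
    refine ripL2L1_of_bounds_on_nets (l := l * a) (u := u * b) hKN (hε8.trans (by norm_num))
      (by positivity) (by linarith) ?_ le_rfl net hnet fun T hT y hy => ?_
    · have h1 : 2 * (u * b) * ε = l * b / 4 := by
        rw [hε]
        field_simp
        ring
      rw [h1]
      nlinarith
    · have h1 := hω T ((hmem T).mpr hT) y hy
      have h2 : ¬ (Z y ω ≤ P * (l * F y) ∨ P * (u * F y) ≤ Z y ω) := h1
      rw [not_or, not_le, not_le] at h2
      obtain ⟨hFa, hFb⟩ := hF T hT y hy
      have hZ : meanAbs (irop S (α ω) (β ω)) y = 1 / (P : ℝ) * Z y ω := by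
        simp only [meanAbs_apply, irop_mulVec]
        rfl
      rw [hZ, one_div_mul_eq_div, le_div_iff₀ hP0, div_le_iff₀ hP0]
      constructor
      · calc l * a * P ≤ P * (l * F y) := by
              rw [mul_comm]
              gcongr
          _ ≤ Z y ω := h2.1.le
      · calc Z y ω ≤ P * (u * F y) := h2.2.le
          _ ≤ u * b * P := by
              rw [mul_comm]
              gcongr
  have h1 := measureReal_union_le (μ := μ)
    {ω | RIPL2L1 (irop S (α ω) (β ω)) K₀ (l * a / 2) (2 * (u * b))}
    {ω | RIPL2L1 (irop S (α ω) (β ω)) K₀ (l * a / 2) (2 * (u * b))}ᶜ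
  rw [Set.union_compl_self, probReal_univ] at h1
  have h2 := (measureReal_mono (μ := μ) hsub (measure_ne_top _ _)).trans_lt hbad
  linarith
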